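/- Let $M$ be a (Hausdorff, finite-dimensional) complex manifold with a Kähler metric $g_M$, and let $\pi:(L,h)\to M$ be a holomorphic line bundle with a smooth Hermitian metric $h$ such that the Kähler form of $g_M$ is $\omega_M=-\sqrt{-1}\,\partial\bar\partial\log h$, where in this formula $h$ also denotes the function $|e|_h^2$ for any local nowhere vanishing holomorphic section $e$ of $L$. Let $L^*$ be the dual bundle with the dual metric $h^{-1}$, let $$D(L^*)=\{v\in L^*:\ |v|_{h^{-1}}<1\}$$ be the disc bundle, with projection again denoted $\pi:D(L^*)\to M$, and put $$\omega_D=\pi^*\omega_M-\sqrt{-1}\,\partial\bar\partial\log\bigl(1-|v|^2_{h^{-1}}\bigr)\quad\text{on } D(L^*).$$ If the Riemannian metric $g_M$ is complete, then $\omega_D$ is the fundamental form of a smooth Hermitian metric $g_D$ on $D(L^*)$, i.e. $\omega_D(u,v)=g_D(Ju,v)$ with $J$ the complex structure, and $g_D$ is complete. Here a metric is complete if every Cauchy sequence for its distance function (the infimum of the lengths of $C^1$ paths, equal to $+\infty$ between different connected components) converges. -/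

import Mathlib

open scoped Manifold ContDiff Topology Bundle

noncomputable section

namespace DiscBundle

section ComplexManifold

/-! Generalities: `X` is a manifold modelled on a complex normed space `V`, regarded as a real
manifold through a real model with corners `I`. The tangent space `T_x X` is the model space `V`,
through the preferred chart at `x`; this is also how multiplication by `i` acts on it. -/

variable {V : Type*} [NormedAddCommGroup V] [NormedSpace ℂ V]
variable {H : Type*} [TopologicalSpace H] (I : ModelWithCorners ℝ V H)
variable {X : Type*} [TopologicalSpace X] [ChartedSpace H X]

/-- The complex structure `J` of `T_x X`: multiplication by `i`. -/
def J (x : X) (u : TangentSpace I x) : TangentSpace I x :=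
  letI w : V := u
  Complex.I • w

/-- The real Hessian at `x` of `f : X → ℝ` in the preferred chart at `x`. -/
def chartHessian (f : X → ℝ) (x : X) (u v : V) : ℝ :=
  fderiv ℝ (fderiv ℝ (f ∘ (extChartAt I x).symm)) (extChartAt I x x) u v

/-- The value at `x` of the real `(1,1)`-form `√-1 ∂∂̄ f`. In holomorphic coordinates
`√-1 ∂∂̄ f = √-1 ∑ f_{j k̄} dz_j ∧ dz̄_k`, whose value on `(u, v)` is
`-2 Im ∑ f_{j k̄} u_j v̄_k = (D²f(iu, v) - D²f(u, iv)) / 2`. -/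
def iddbar (f : X → ℝ) (x : X) (u v : TangentSpace I x) : ℝ :=
  (chartHessian I f x (J I x u) v - chartHessian I f x u (J I x v)) / 2

variable [IsManifold I ∞ X]

/-- The smooth Riemannian metric `g` is Hermitian (`J` is an isometry of each tangent space) and
`Ω` is its fundamental form, `Ω(u, v) = g(J u, v)`; equivalently `g(u, v) = Ω(u, J v)`. -/
def IsHermitianWithForm
    (g : Bundle.ContMDiffRiemannianMetric I ∞ V (fun x : X ↦ TangentSpace I x))
    (Ω : ∀ x : X, TangentSpace I x → TangentSpace I x → ℝ) : Prop :=
  ∀ (x : X) (u v : TangentSpace I x),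
    g.inner x (J I x u) (J I x v) = g.inner x u v ∧ Ω x u v = g.inner x (J I x u) v

/-- The (extended) distance of a Riemannian metric: the infimum of the lengths of `C^1` paths. -/
def metricDist (g : Bundle.ContMDiffRiemannianMetric I ∞ V (fun x : X ↦ TangentSpace I x))
    (x y : X) : ENNReal :=
  letI : Bundle.RiemannianBundle (fun x : X ↦ TangentSpace I x) := ⟨g.toRiemannianMetric⟩
  Manifold.riemannianEDist I x y

/-- A Riemannian metric is complete if every Cauchy sequence for its distance converges. -/
def IsCompleteMetric
    (g : Bundle.ContMDiffRiemannianMetric I ∞ V (fun x : X ↦ TangentSpace I x)) : Prop :=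
  ∀ a : ℕ → X,
    (∀ ε : ENNReal, 0 < ε → ∃ N, ∀ j ≥ N, ∀ k ≥ N, metricDist I g (a j) (a k) < ε) →
    ∃ x : X, Filter.Tendsto (fun j ↦ metricDist I g (a j) x) Filter.atTop (𝓝 0)

end ComplexManifold

section RealStructure

variable {E F : Type*} [NormedAddCommGroup E] [NormedSpace ℂ E]
  [NormedAddCommGroup F] [NormedSpace ℂ F]

/-- A complex manifold is a smooth real manifold. -/
instance isManifold_real {M : Type*} [TopologicalSpace M] [ChartedSpace E M]
    [IsManifold 𝓘(ℂ, E) ω M] : IsManifold 𝓘(ℝ, E) ∞ M := by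
  refine isManifold_of_contDiffOn _ _ _ fun e e' he he' ↦ ?_
  have h := ((mem_groupoid_of_pregroupoid.1
    (HasGroupoid.compatible (G := contDiffGroupoid ω 𝓘(ℂ, E)) he he')).1)
  exact (ContDiffOn.restrict_scalars ℝ h).of_le (by exact le_top)

/-- The same for a complex manifold modelled on a product (such as the total space of a bundle). -/
instance isManifold_real_prod {X : Type*} [TopologicalSpace X] [ChartedSpace (ModelProd E F) X]
    [IsManifold (𝓘(ℂ, E).prod 𝓘(ℂ, F)) ω X] :
    IsManifold (𝓘(ℝ, E).prod 𝓘(ℝ, F)) ∞ X := by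
  refine isManifold_of_contDiffOn _ _ _ fun e e' he he' ↦ ?_
  have h := ((mem_groupoid_of_pregroupoid.1
    (HasGroupoid.compatible (G := contDiffGroupoid ω (𝓘(ℂ, E).prod 𝓘(ℂ, F))) he he')).1)
  exact (ContDiffOn.restrict_scalars ℝ h).of_le (by exact le_top)

end RealStructure

section LineBundle

variable (E : Type*) [NormedAddCommGroup E] [NormedSpace ℂ E]
variable {M : Type*} [TopologicalSpace M] [ChartedSpace E M]
variable (L : M → Type*) [∀ x, AddCommGroup (L x)] [∀ x, Module ℂ (L x)]
  [∀ x, TopologicalSpace (L x)] [TopologicalSpace (Bundle.TotalSpace ℂ L)]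
  [FiberBundle ℂ L] [VectorBundle ℂ ℂ L]

/-- A smooth Hermitian metric on the complex line bundle `L`. Smoothness is expressed by that of
`s ↦ h(s, s)` on the total space (as a real manifold). -/
structure HermitianMetric where
  /-- The Hermitian inner product of each fibre, linear in the second variable. -/
  inner (x : M) : L x →ₗ⋆[ℂ] L x →ₗ[ℂ] ℂ
  conj_symm (x : M) (s t : L x) : (starRingEnd ℂ) (inner x s t) = inner x t s
  pos (x : M) (s : L x) (hs : s ≠ 0) : 0 < (inner x s s).re
  smooth : ContMDiff (𝓘(ℝ, E).prod 𝓘(ℝ, ℂ)) 𝓘(ℝ, ℝ) ∞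
    (fun p : Bundle.TotalSpace ℂ L ↦ (inner p.1 p.2 p.2).re)

/-- The total space of the dual bundle `L^*`. -/
abbrev DualTotal : Type _ :=
  Bundle.TotalSpace (ℂ →L[ℂ] ℂ) (fun x : M ↦ L x →L[ℂ] Bundle.Trivial M ℂ x)

variable {E L}

namespace HermitianMetric

variable (h : HermitianMetric E L)

/-- `|s|_h² = h(s, s)`. -/
def normSq (x : M) (s : L x) : ℝ := (h.inner x s s).re

/-- The local function representing `h` in the preferred trivialization around `x`, that is
`z ↦ |e(z)|_h²` for the corresponding local holomorphic frame `e`. -/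
def localWeight (x z : M) : ℝ :=
  h.normSq z ((trivializationAt ℂ L x).symm z 1)

/-- The curvature form `-√-1 ∂∂̄ log h`. -/
def curvatureForm (x : M) (u v : TangentSpace 𝓘(ℝ, E) x) : ℝ :=
  -iddbar 𝓘(ℝ, E) (fun z ↦ Real.log (h.localWeight x z)) x u v

/-- The squared norm `|v|²` of `v ∈ L^*` for the dual metric `h⁻¹`:
the supremum of `|v(s)|² / |s|_h²` over `s`. -/
def dualNormSq (v : DualTotal L) : ℝ :=
  ⨆ s : L v.1, ‖(v.2 s : ℂ)‖ ^ 2 / h.normSq v.1 s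

theorem dualNormSq_eq_of_frame (v : DualTotal L) (s : L v.1) (hs : s ≠ 0)
    (hspan : ∀ t : L v.1, ∃ c : ℂ, t = c • s) :
    h.dualNormSq v = ‖(v.2 s : ℂ)‖ ^ 2 / h.normSq v.1 s := by
  have key : ∀ t : L v.1, ‖(v.2 t : ℂ)‖ ^ 2 / h.normSq v.1 t ≤
      ‖(v.2 s : ℂ)‖ ^ 2 / h.normSq v.1 s := by
    intro t
    obtain ⟨c, rfl⟩ := hspan t
    have e1 : h.normSq v.1 (c • s) = ‖c‖ ^ 2 * h.normSq v.1 s := by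
      have : h.inner v.1 (c • s) (c • s) = ((‖c‖ ^ 2 : ℝ) : ℂ) * h.inner v.1 s s := by
        rw [LinearMap.map_smul, LinearMap.map_smulₛₗ₂, smul_eq_mul,
          smul_eq_mul, ← mul_assoc, Complex.mul_conj,
          Complex.normSq_eq_norm_sq]
      rw [normSq, this, Complex.re_ofReal_mul, normSq]
    have e2 : ‖(v.2 (c • s) : ℂ)‖ = ‖c‖ * ‖(v.2 s : ℂ)‖ := by
      have : (v.2 (c • s) : ℂ) = c * (v.2 s : ℂ) := by
        rw [ContinuousLinearMap.map_smul]; rfl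
      rw [this, norm_mul]
    have hp : 0 < h.normSq v.1 s := h.pos _ _ hs
    rw [e1, e2]
    by_cases hc : c = 0
    · subst hc
      simp only [norm_zero, zero_mul, ne_eq, OfNat.ofNat_ne_zero, not_false_eq_true, zero_pow,
        div_zero]
      positivity
    · have : 0 < ‖c‖ := norm_pos_iff.2 hc
      rw [mul_pow, mul_div_mul_left _ _ (by positivity)]
  have : Nonempty (L v.1) := ⟨0⟩
  exact le_antisymm (ciSup_le key)
    (le_ciSup (f := fun t : L v.1 ↦ ‖(v.2 t : ℂ)‖ ^ 2 / h.normSq v.1 t)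
      ⟨_, by rintro _ ⟨t, rfl⟩; exact key t⟩ s)

end HermitianMetric

theorem HermitianMetric.continuous_dualNormSq (h : HermitianMetric E L) :
    Continuous h.dualNormSq := by
  rw [continuous_iff_continuousAt]
  intro v₀
  set x₀ := v₀.1 with hx₀
  set e := trivializationAt ℂ L x₀ with he
  have hbase : e.baseSet ∈ 𝓝 x₀ :=
    e.open_baseSet.mem_nhds (FiberBundle.mem_baseSet_trivializationAt' x₀)
  have hproj : ContinuousAt (fun v : DualTotal L ↦ v.1) v₀ :=
    (FiberBundle.continuous_proj (ℂ →L[ℂ] ℂ)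
      (fun x : M ↦ L x →L[ℂ] Bundle.Trivial M ℂ x)).continuousAt
  have hden : ContinuousAt (fun z ↦ h.normSq z (e.symm z 1)) x₀ := by
    have h1 : ContinuousAt (fun z : M ↦ e.toOpenPartialHomeomorph.symm (z, (1 : ℂ))) x₀ := by
      refine ContinuousAt.comp (x := x₀)
        (g := e.toOpenPartialHomeomorph.symm) (f := fun z : M ↦ (z, (1 : ℂ))) ?_ (by fun_prop)
      refine e.toOpenPartialHomeomorph.continuousAt_symm ?_
      rw [e.mem_target]
      exact FiberBundle.mem_baseSet_trivializationAt' x₀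
    have h2 := h.smooth.continuous.continuousAt.comp (x := x₀) h1
    refine h2.congr ?_
    filter_upwards [hbase] with z hz
    have hm := e.mk_symm hz (1 : ℂ)
    exact congrArg (fun p : Bundle.TotalSpace ℂ L ↦ (h.inner p.1 p.2 p.2).re) hm.symm
  have hnum : ContinuousAt (fun v : DualTotal L ↦ ‖(v.2 (e.symm v.1 1) : ℂ)‖) v₀ := by
    have h1 := (continuousAt_hom_bundle (RingHom.id ℂ) (fun v : DualTotal L ↦ v)
      (x₀ := v₀)).1 continuousAt_id
    have h2 := (h1.2.clm_apply (continuousAt_const (y := (1 : ℂ)))).norm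
    refine h2.congr ?_
    filter_upwards [hproj hbase] with v hv
    congr 1
    rw [ContinuousLinearMap.inCoordinates]
    simp only [ContinuousLinearMap.comp_apply]
    rw [Bundle.Trivialization.continuousLinearMapAt_apply,
      Bundle.Trivialization.linearMapAt_apply,
      if_pos (show v.1 ∈ (trivializationAt ℂ (Bundle.Trivial M ℂ) v₀.1).baseSet from trivial)]
    exact congrArg v.2 (e.symmL_apply (R := ℂ) hv (1 : ℂ))
  have hne : ∀ z ∈ e.baseSet, e.symm z 1 ≠ 0 := by
    intro z hz h0
    have h1 := (e.continuousLinearEquivAt ℂ z hz).symm.injective.ne (one_ne_zero (α := ℂ))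
    rw [map_zero] at h1
    exact h1 h0
  have hq : ContinuousAt (fun v : DualTotal L ↦
      ‖(v.2 (e.symm v.1 1) : ℂ)‖ ^ 2 / h.normSq v.1 (e.symm v.1 1)) v₀ := by
    refine (hnum.pow 2).div
      (ContinuousAt.comp (g := fun z ↦ h.normSq z (e.symm z 1)) (x := v₀) hden hproj) ?_
    exact (h.pos _ _ (hne _ (FiberBundle.mem_baseSet_trivializationAt' x₀))).ne'
  refine hq.congr ?_
  filter_upwards [hproj hbase] with v hv
  refine (h.dualNormSq_eq_of_frame v _ (hne _ hv) fun t ↦ ?_).symm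
  refine ⟨e.continuousLinearEquivAt ℂ v.1 hv t, ?_⟩
  have h1 := (e.continuousLinearEquivAt ℂ v.1 hv).symm_apply_apply t
  have h2 : e.symm v.1 1 = (e.continuousLinearEquivAt ℂ v.1 hv).symm 1 := rfl
  rw [h2, ← map_smul, smul_eq_mul, mul_one, h1]

/-- The disc bundle `D(L^*) = {v ∈ L^* : |v| < 1}`, an open subset of the total space of `L^*`. -/
def discBundle (h : HermitianMetric E L) : TopologicalSpace.Opens (DualTotal L) :=
  ⟨{v | h.dualNormSq v < 1}, isOpen_lt h.continuous_dualNormSq continuous_const⟩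

variable (E) in
/-- The total space of `L^*` has complex dimension `dim M + 1`; this is its model with corners as a
real manifold. -/
abbrev totalModel := (𝓘(ℝ, E).prod 𝓘(ℝ, ℂ →L[ℂ] ℂ))

/-- The projection `π : D(L^*) → M`. -/
def discProj (h : HermitianMetric E L) (p : discBundle h) : M := p.1.1

/-- The form `ω_D = π^* ω_M - √-1 ∂∂̄ log(1 - |v|²)` on the disc bundle, where `ω_M` is the
curvature form of `h`. -/
def discForm (h : HermitianMetric E L) (p : discBundle h)
    (u v : TangentSpace (totalModel E) p) : ℝ :=
  h.curvatureForm (discProj h p)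
      (mfderiv (totalModel E) 𝓘(ℝ, E) (discProj h) p u)
      (mfderiv (totalModel E) 𝓘(ℝ, E) (discProj h) p v)
    - iddbar (totalModel E) (fun q : discBundle h ↦ Real.log (1 - h.dualNormSq q.1)) p u v

end LineBundle

end DiscBundle

end

/-! Choose a holomorphic frame `e` of `L` over a chart. Let `H = |e|²` be its weight and `w` the
fibre coordinate on `L^*`, so that `|v|² = |w|² / H`. Both terms of `ω_D` then merge into one
potential: `log H + log (1 - |w|² / H) = log Q`, where `Q = H - |w|²`, and the metric is minus the
Levi form of `log Q` (`discInner_self`). Everything rests on completing a square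
(`leviForm_log_discPotential`): `g_D(u, u) = (H / Q) g_M(dπ u, dπ u) + (2 H / Q²) |α(u)|²`, with `α
= dw - w ∂ log H`.

Three facts follow. The form is positive definite. Since `H / Q ≥ 1`, the projection to `M` does not
increase distances (`inner_le_discInner`). Since `d log (1 - |v|²) = -2 Re(w̄ α) / Q` and `|w|² ≤
H`, the square of this differential is at most `2 g_D`, so `log (1 - |v|²)` is Lipschitz
(`edist_logDefect_le`): the boundary of the disc is infinitely far away.

A Cauchy sequence in `D(L^*)` therefore projects to a Cauchy sequence of `M`, which converges by
completeness, while `|v|²` eventually stays below a constant `c < 1`. The fibre coordinates are then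
bounded, a subsequence converges inside the disc bundle (`exists_subseq_tendsto`), and a Cauchy
sequence with a convergent subsequence converges. -/

noncomputable section

namespace DiscBundle

/-! ### Levi forms on complex normed spaces. -/

section LeviForm

variable {V W : Type*} [NormedAddCommGroup V] [NormedSpace ℂ V]
  [NormedAddCommGroup W] [NormedSpace ℂ W]

/-- Multiplication by `i` as a real continuous linear map. -/
def mulI (V : Type*) [NormedAddCommGroup V] [NormedSpace ℂ V] : V →L[ℝ] V :=
  (Complex.I • ContinuousLinearMap.id ℂ V).restrictScalars ℝ

@[simp] theorem mulI_apply (u : V) : mulI V u = Complex.I • u := rfl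

/-- Precomposition of a real linear form with multiplication by `i`. -/
def precompI (V : Type*) [NormedAddCommGroup V] [NormedSpace ℂ V] :
    (V →L[ℝ] ℝ) →L[ℝ] (V →L[ℝ] ℝ) :=
  (ContinuousLinearMap.compL ℝ V V ℝ).flip (mulI V)

/-- The Levi form of `f` at `y`: the `J`-invariant part of the real Hessian. -/
def leviForm (f : V → ℝ) (y : V) : V →L[ℝ] V →L[ℝ] ℝ :=
  (1 / 2 : ℝ) • (fderiv ℝ (fderiv ℝ f) y +
    (precompI V).comp ((fderiv ℝ (fderiv ℝ f) y).comp (mulI V)))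

theorem leviForm_apply (f : V → ℝ) (y u v : V) :
    leviForm f y u v = (fderiv ℝ (fderiv ℝ f) y u v +
      fderiv ℝ (fderiv ℝ f) y (Complex.I • u) (Complex.I • v)) / 2 := by
  simp [leviForm, precompI]
  ring

theorem leviForm_symm {f : V → ℝ} {y : V} (hf : ContDiffAt ℝ 2 f y) (u v : V) :
    leviForm f y u v = leviForm f y v u := by
  have h : IsSymmSndFDerivAt ℝ f y := hf.isSymmSndFDerivAt (by simp)
  rw [leviForm_apply, leviForm_apply, h.eq u v, h.eq (Complex.I • u)]

theorem leviForm_I_smul (f : V → ℝ) (y u v : V) :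
    leviForm f y (Complex.I • u) (Complex.I • v) = leviForm f y u v := by
  simp only [leviForm_apply, smul_smul, Complex.I_mul_I, neg_smul, one_smul, map_neg,
    neg_apply, neg_neg]
  ring

theorem leviForm_congr {f g : V → ℝ} {y : V} (h : f =ᶠ[𝓝 y] g) :
    leviForm f y = leviForm g y := by
  rw [leviForm, leviForm, h.fderiv.fderiv_eq]

set_option synthInstance.maxHeartbeats 200000 in
theorem leviForm_sub {f g : V → ℝ} {y : V} (hf : ContDiffAt ℝ 2 f y) (hg : ContDiffAt ℝ 2 g y) :
    leviForm (fun x ↦ f x - g x) y = leviForm f y - leviForm g y := by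
  have h1 : fderiv ℝ (fun x ↦ f x - g x) =ᶠ[𝓝 y] fun x ↦ fderiv ℝ f x - fderiv ℝ g x := by
    filter_upwards [hf.eventually (by simp), hg.eventually (by simp)] with x hx hx'
    exact fderiv_fun_sub (hx.differentiableAt (by simp)) (hx'.differentiableAt (by simp))
  have h2 : ∀ {k : V → ℝ}, ContDiffAt ℝ 2 k y → DifferentiableAt ℝ (fderiv ℝ k) y :=
    fun hk ↦ (hk.fderiv_right (m := 1) (by norm_num)).differentiableAt (by simp)
  ext u v
  simp only [leviForm_apply, h1.fderiv_eq, fderiv_fun_sub (h2 hf) (h2 hg), sub_apply]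
  ring

set_option synthInstance.maxHeartbeats 200000 in
theorem leviForm_contDiffAt {f : V → ℝ} {y : V} (hf : ContDiffAt ℝ ∞ f y) :
    ContDiffAt ℝ ∞ (leviForm f) y := by
  have h1 : ContDiffAt ℝ ∞ (fderiv ℝ (fderiv ℝ f)) y :=
    (hf.fderiv_right (m := ∞) (by simp)).fderiv_right (m := ∞) (by simp)
  exact (h1.add (contDiffAt_const.clm_comp (h1.clm_comp contDiffAt_const))).const_smul _

/-- The Levi form is natural under holomorphic maps. -/
theorem leviForm_comp {f : W → ℝ} {φ : V → W} {y : V} (hf : ContDiffAt ℝ 2 f (φ y))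
    (hφ : ContDiffAt ℂ 2 φ y) (u v : V) :
    leviForm (f ∘ φ) y u v = leviForm f (φ y) (fderiv ℂ φ y u) (fderiv ℂ φ y v) := by
  have hφd : DifferentiableAt ℂ φ y := hφ.differentiableAt (by simp)
  have h1 : fderiv ℝ (f ∘ φ) =ᶠ[𝓝 y] fun x ↦ (fderiv ℝ f (φ x)).comp
      (ContinuousLinearMap.restrictScalarsL ℂ V W ℝ ℝ (fderiv ℂ φ x)) := by
    filter_upwards [hφ.continuousAt.eventually (hf.eventually (by simp)),
      hφ.eventually (by simp)] with x hx hx'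
    have h3 := (hx'.differentiableAt (by simp)).hasFDerivAt.restrictScalars ℝ
    exact ((hx.differentiableAt (by simp)).hasFDerivAt.comp x h3).fderiv
  have hf2 : HasFDerivAt (fun x ↦ fderiv ℝ f (φ x)) _ y :=
    ((hf.fderiv_right (m := 1) (by norm_num)).differentiableAt (by simp)).hasFDerivAt.comp y
      (hφd.hasFDerivAt.restrictScalars ℝ)
  have hφ2 : HasFDerivAt (fun x ↦ ContinuousLinearMap.restrictScalarsL ℂ V W ℝ ℝ (fderiv ℂ φ x))
      _ y := (ContinuousLinearMap.restrictScalarsL ℂ V W ℝ ℝ).hasFDerivAt.comp y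
    (((hφ.fderiv_right (m := 1) (by norm_num)).differentiableAt
      (by simp)).hasFDerivAt.restrictScalars ℝ)
  have key : ∀ a b : V, fderiv ℝ (fderiv ℝ (f ∘ φ)) y a b =
      fderiv ℝ f (φ y) (fderiv ℂ (fderiv ℂ φ) y a b) +
      fderiv ℝ (fderiv ℝ f) (φ y) (fderiv ℂ φ y a) (fderiv ℂ φ y b) := by
    intro a b
    rw [h1.fderiv_eq, (hf2.clm_comp hφ2).fderiv]
    simp
  rw [leviForm_apply, leviForm_apply, key, key]
  -- The second derivative of `φ` is complex bilinear, so its value at `(iu, iv)` is minus that at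
  -- `(u, v)`, and the first-order terms in `f` cancel.
  simp only [map_smul, smul_apply, smul_smul, Complex.I_mul_I, neg_smul,
    one_smul, map_neg]
  ring

/-- The subtracted term is `2 |∂q(u)|² / q²`, since `∂q(u) = (dq(u) - i dq(iu)) / 2`. -/
theorem leviForm_log {q : V → ℝ} {y : V} (hq : ContDiffAt ℝ 2 q y) (h0 : q y ≠ 0) (u : V) :
    leviForm (fun x ↦ Real.log (q x)) y u u = leviForm q y u u / q y -
      (fderiv ℝ q y u ^ 2 + fderiv ℝ q y (Complex.I • u) ^ 2) / (2 * q y ^ 2) := by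
  have h1 : fderiv ℝ (fun x ↦ Real.log (q x)) =ᶠ[𝓝 y] fun x ↦ (q x)⁻¹ • fderiv ℝ q x := by
    filter_upwards [hq.eventually (by simp), hq.continuousAt.eventually_ne h0] with x hx hx'
    exact ((hx.differentiableAt (by simp)).hasFDerivAt.log hx').fderiv
  have hd : HasFDerivAt q (fderiv ℝ q y) y := (hq.differentiableAt (by simp)).hasFDerivAt
  have hd2 : HasFDerivAt (fderiv ℝ q) (fderiv ℝ (fderiv ℝ q) y) y :=
    ((hq.fderiv_right (m := 1) (by norm_num)).differentiableAt (by simp)).hasFDerivAt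
  have hi : HasFDerivAt (fun x ↦ (q x)⁻¹) _ y := (hasDerivAt_inv h0).comp_hasFDerivAt y hd
  have key : ∀ a b : V, fderiv ℝ (fderiv ℝ (fun x ↦ Real.log (q x))) y a b =
      fderiv ℝ (fderiv ℝ q) y a b / q y - fderiv ℝ q y a * fderiv ℝ q y b / q y ^ 2 := by
    intro a b
    rw [h1.fderiv_eq, (hi.fun_smul hd2).fderiv]
    simp
    field_simp
    ring
  rw [leviForm_apply, leviForm_apply, key, key]
  field_simp
  ring

theorem leviForm_norm_sq (w u : ℂ) : leviForm (fun x : ℂ ↦ ‖x‖ ^ 2) w u u = 2 * ‖u‖ ^ 2 := by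
  have h1 : fderiv ℝ (fun x : ℂ ↦ ‖x‖ ^ 2) = fun x ↦ (2 • innerSL ℝ : ℂ →L[ℝ] ℂ →L[ℝ] ℝ) x := by
    funext x
    rw [fderiv_norm_sq]; rfl
  have h2 : ∀ a : ℂ, fderiv ℝ (fderiv ℝ (fun x : ℂ ↦ ‖x‖ ^ 2)) w a a = 2 * ‖a‖ ^ 2 := by
    intro a
    rw [h1, ContinuousLinearMap.fderiv, ← real_inner_self_eq_norm_sq a, two_mul, two_smul]
    rfl
  rw [leviForm_apply, h2, h2, norm_smul, Complex.norm_I]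
  ring

end LeviForm

/-! ### The local model: the potential `log (H - |w|²)`. -/

section DiscModel

variable {E F : Type*} [NormedAddCommGroup E] [NormedSpace ℂ E]
  [NormedAddCommGroup F] [NormedSpace ℂ F]

theorem leviForm_comp_fst {f : E → ℝ} {y : E × F} (hf : ContDiffAt ℝ 2 f y.1) (u v : E × F) :
    leviForm (fun x : E × F ↦ f x.1) y u v = leviForm f y.1 u.1 v.1 := by
  have h := leviForm_comp (φ := (Prod.fst : E × F → E)) hf contDiffAt_fst u v
  rw [fderiv_fst] at h
  exact h

theorem leviForm_norm_sq_comp (ℓ : F →L[ℂ] ℂ) (y u : E × F) :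
    leviForm (fun x : E × F ↦ ‖ℓ x.2‖ ^ 2) y u u = 2 * ‖ℓ u.2‖ ^ 2 := by
  have h := leviForm_comp (f := fun x : ℂ ↦ ‖x‖ ^ 2)
    (φ := ⇑(ℓ.comp (ContinuousLinearMap.snd ℂ E F))) (y := y)
    (contDiff_norm_sq ℝ).contDiffAt (ContinuousLinearMap.contDiff _).contDiffAt u u
  rw [ContinuousLinearMap.fderiv, leviForm_norm_sq] at h
  exact h

theorem fderiv_norm_sq_comp (ℓ : F →L[ℂ] ℂ) (y u : E × F) :
    fderiv ℝ (fun x : E × F ↦ ‖ℓ x.2‖ ^ 2) y u =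
      2 * ((ℓ y.2).re * (ℓ u.2).re + (ℓ y.2).im * (ℓ u.2).im) := by
  have h := ((ℓ.comp (ContinuousLinearMap.snd ℂ E F)).restrictScalars
    ℝ).hasFDerivAt (x := y) |>.norm_sq
  have e : (fun x : E × F ↦ ‖ℓ x.2‖ ^ 2) = fun x ↦
      ‖((ℓ.comp (ContinuousLinearMap.snd ℂ E F)).restrictScalars ℝ) x‖ ^ 2 := rfl
  rw [e, h.fderiv]
  change (2 : ℕ) • inner ℝ (ℓ y.2) (ℓ u.2) = _
  rw [Complex.inner]
  simp
  ring

/-- The function `H - |w|²` on a product, where `w` is a linear coordinate on the second factor. -/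
def discPotential (H : E → ℝ) (ℓ : F →L[ℂ] ℂ) (x : E × F) : ℝ := H x.1 - ‖ℓ x.2‖ ^ 2

variable {H : E → ℝ} {ℓ : F →L[ℂ] ℂ} {y : E × F}

theorem contDiff_norm_sq_comp (ℓ : F →L[ℂ] ℂ) {n : WithTop ℕ∞} :
    ContDiff ℝ n (fun x : E × F ↦ ‖ℓ x.2‖ ^ 2) :=
  ((ℓ.comp (ContinuousLinearMap.snd ℂ E F)).restrictScalars ℝ).contDiff.norm_sq ℝ

theorem contDiffAt_discPotential {n : WithTop ℕ∞} (hH : ContDiffAt ℝ n H y.1) :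
    ContDiffAt ℝ n (discPotential H ℓ) y :=
  (hH.comp y contDiffAt_fst).sub (contDiff_norm_sq_comp ℓ).contDiffAt

theorem fderiv_discPotential (hH : ContDiffAt ℝ 2 H y.1) (u : E × F) :
    fderiv ℝ (discPotential H ℓ) y u = fderiv ℝ H y.1 u.1 -
      2 * ((ℓ y.2).re * (ℓ u.2).re + (ℓ y.2).im * (ℓ u.2).im) := by
  have h1 : HasFDerivAt (fun x : E × F ↦ H x.1) _ y :=
    (hH.differentiableAt (by simp)).hasFDerivAt.comp y (hasFDerivAt_fst (𝕜 := ℝ) (p := y))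
  have h2 : DifferentiableAt ℝ (fun x : E × F ↦ ‖ℓ x.2‖ ^ 2) y :=
    (contDiff_norm_sq_comp ℓ (n := 1)).contDiffAt.differentiableAt (by simp)
  unfold discPotential
  rw [fderiv_fun_sub h1.differentiableAt h2, sub_apply, fderiv_norm_sq_comp, h1.fderiv]
  rfl

theorem leviForm_discPotential (hH : ContDiffAt ℝ 2 H y.1) (u : E × F) :
    leviForm (discPotential H ℓ) y u u = leviForm H y.1 u.1 u.1 - 2 * ‖ℓ u.2‖ ^ 2 := by
  have h := leviForm_sub (hH.comp y contDiffAt_fst) (contDiff_norm_sq_comp (E := E) ℓ).contDiffAt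
  unfold discPotential
  refine (congrArg (fun B : E × F →L[ℝ] E × F →L[ℝ] ℝ ↦ B u u) h).trans ?_
  rw [sub_apply, sub_apply, leviForm_norm_sq_comp]
  exact congrArg (· - _) (leviForm_comp_fst hH u u)

/-- The `(1, 0)`-part of the Chern connection of the dual metric in a local frame, where `w` is the
fibre coordinate. -/
def connectionForm (H : E → ℝ) (ℓ : F →L[ℂ] ℂ) (y u : E × F) : ℂ :=
  ℓ u.2 - ⟨fderiv ℝ H y.1 u.1 / (2 * H y.1), -fderiv ℝ H y.1 (Complex.I • u.1) / (2 * H y.1)⟩ *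
    ℓ y.2

/-- `-√-1 ∂∂̄ log (H - |w|²)` is the sum of a multiple of `-√-1 ∂∂̄ log H` and the square of the
connection form. -/
theorem leviForm_log_discPotential (hH : ContDiffAt ℝ 2 H y.1) (hpos : 0 < H y.1)
    (hQ : 0 < discPotential H ℓ y) (u : E × F) :
    -leviForm (fun x ↦ Real.log (discPotential H ℓ x)) y u u =
      H y.1 / discPotential H ℓ y * -leviForm (fun x ↦ Real.log (H x)) y.1 u.1 u.1 +
      2 * H y.1 / discPotential H ℓ y ^ 2 * ‖connectionForm H ℓ y u‖ ^ 2 := by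
  have hw : ‖ℓ y.2‖ ^ 2 = H y.1 - discPotential H ℓ y := by simp [discPotential]
  rw [← Complex.normSq_eq_norm_sq, Complex.normSq_apply] at hw
  rw [leviForm_log (contDiffAt_discPotential hH) hQ.ne', leviForm_log hH hpos.ne',
    leviForm_discPotential hH, fderiv_discPotential hH, fderiv_discPotential hH]
  rw [← Complex.normSq_eq_norm_sq, ← Complex.normSq_eq_norm_sq, Complex.normSq_apply,
    Complex.normSq_apply, connectionForm]
  simp only [Prod.smul_fst, Prod.smul_snd, map_smul, smul_eq_mul, Complex.mul_re, Complex.mul_im,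
    Complex.I_re, Complex.I_im, Complex.sub_re, Complex.sub_im]
  generalize fderiv ℝ H y.1 u.1 = A at *
  generalize fderiv ℝ H y.1 (Complex.I • u.1) = B at *
  generalize leviForm H y.1 u.1 u.1 = R at *
  generalize discPotential H ℓ y = Q at *
  generalize H y.1 = h at *
  generalize (ℓ y.2).re = a at *
  generalize (ℓ y.2).im = b at *
  generalize (ℓ u.2).re = c at *
  generalize (ℓ u.2).im = d at *
  -- Eliminating `H` through `H = Q + |w|²` leaves a rational identity in independent variables.
  obtain rfl : h = Q + a * a + b * b := by linarith
  field_simp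
  ring

/-- Drop the connection square and use `H / Q ≥ 1`. This is what makes the projection to the base
distance-nonincreasing. -/
theorem leviForm_le_leviForm_log_discPotential (hH : ContDiffAt ℝ 2 H y.1) (hpos : 0 < H y.1)
    (hQ : 0 < discPotential H ℓ y) (u : E × F)
    (hg : 0 ≤ -leviForm (fun x ↦ Real.log (H x)) y.1 u.1 u.1) :
    -leviForm (fun x ↦ Real.log (H x)) y.1 u.1 u.1 ≤
      -leviForm (fun x ↦ Real.log (discPotential H ℓ x)) y u u := by
  rw [leviForm_log_discPotential hH hpos hQ]
  have h1 : 1 ≤ H y.1 / discPotential H ℓ y := by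
    rw [one_le_div hQ, discPotential]
    exact sub_le_self _ (sq_nonneg _)
  have h2 : 0 ≤ 2 * H y.1 / discPotential H ℓ y ^ 2 * ‖connectionForm H ℓ y u‖ ^ 2 := by
    positivity
  nlinarith

/-- A vector with nonzero base part is detected by the first summand. On a vertical vector the
connection form is just `ℓ`, which is injective. -/
theorem leviForm_log_discPotential_pos (hH : ContDiffAt ℝ 2 H y.1) (hpos : 0 < H y.1)
    (hQ : 0 < discPotential H ℓ y) (hℓ : ∀ w, ℓ w = 0 → w = 0) (u : E × F) (hu : u ≠ 0)
    (hg : ∀ v : E, v ≠ 0 → 0 < -leviForm (fun x ↦ Real.log (H x)) y.1 v v) :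
    0 < -leviForm (fun x ↦ Real.log (discPotential H ℓ x)) y u u := by
  rw [leviForm_log_discPotential hH hpos hQ]
  by_cases h1 : u.1 = 0
  · have h2 : ℓ u.2 ≠ 0 := fun h ↦ hu (Prod.ext h1 (hℓ _ h))
    have h3 : connectionForm H ℓ y u = ℓ u.2 := by
      have : (⟨0, 0⟩ : ℂ) = 0 := rfl
      simp [connectionForm, h1, this]
    rw [h3, h1]
    simp only [map_zero, neg_zero, mul_zero, zero_add]
    positivity
  · have := hg _ h1
    positivity

/-- The differential of `-log (1 - |w|² / H) = log H - log (H - |w|²)` is bounded by the metric. -/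
theorem sq_fderiv_log_sub_log_le (hH : ContDiffAt ℝ 2 H y.1) (hpos : 0 < H y.1)
    (hQ : 0 < discPotential H ℓ y) (u : E × F)
    (hg : 0 ≤ -leviForm (fun x ↦ Real.log (H x)) y.1 u.1 u.1) :
    fderiv ℝ (fun x : E × F ↦ Real.log (H x.1) - Real.log (discPotential H ℓ x)) y u ^ 2 ≤
      2 * -leviForm (fun x ↦ Real.log (discPotential H ℓ x)) y u u := by
  have h1 : HasFDerivAt (fun x : E × F ↦ H x.1) _ y :=
    (hH.differentiableAt (by simp)).hasFDerivAt.comp y (hasFDerivAt_fst (𝕜 := ℝ) (p := y))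
  have h2 : HasFDerivAt (discPotential H ℓ) _ y :=
    ((contDiffAt_discPotential hH).differentiableAt (by simp)).hasFDerivAt
  have hw : ‖ℓ y.2‖ ^ 2 = H y.1 - discPotential H ℓ y := by simp [discPotential]
  rw [← Complex.normSq_eq_norm_sq, Complex.normSq_apply] at hw
  have key : fderiv ℝ (fun x : E × F ↦ Real.log (H x.1) - Real.log (discPotential H ℓ x)) y u =
      2 * ((ℓ y.2).re * (connectionForm H ℓ y u).re + (ℓ y.2).im * (connectionForm H ℓ y u).im) /
        discPotential H ℓ y := by
    rw [((h1.log hpos.ne').fun_sub (h2.log hQ.ne')).fderiv]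
    simp only [sub_apply, smul_apply, fderiv_discPotential hH, connectionForm,
      ContinuousLinearMap.comp_apply, ContinuousLinearMap.coe_fst', smul_eq_mul, Complex.mul_re,
      Complex.mul_im, Complex.sub_re, Complex.sub_im]
    generalize fderiv ℝ H y.1 u.1 = A at *
    generalize fderiv ℝ H y.1 (Complex.I • u.1) = B at *
    generalize discPotential H ℓ y = Q at *
    generalize H y.1 = h at *
    generalize (ℓ y.2).re = a at *
    generalize (ℓ y.2).im = b at *
    obtain rfl : h = Q + a * a + b * b := by linarith
    field_simp
    ring
  rw [key, leviForm_log_discPotential hH hpos hQ]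
  have hg' : 0 ≤ H y.1 / discPotential H ℓ y * -leviForm (fun x ↦ Real.log (H x)) y.1 u.1 u.1 :=
    mul_nonneg (by positivity) hg
  refine le_trans ?_ (mul_le_mul_of_nonneg_left (le_add_of_nonneg_left hg') zero_le_two)
  rw [← Complex.normSq_eq_norm_sq, Complex.normSq_apply, div_pow, div_mul_eq_mul_div, ← mul_div_assoc]
  refine div_le_div_of_nonneg_right ?_ (by positivity)
  generalize (connectionForm H ℓ y u).re = c at *
  generalize (connectionForm H ℓ y u).im = d at *
  generalize (ℓ y.2).re = a at *
  generalize (ℓ y.2).im = b at *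
  have h3 : a * a + b * b ≤ H y.1 := by linarith
  -- Cauchy–Schwarz `Re(w̄ α)² ≤ |w|² |α|²`, through Lagrange's identity, followed by `|w|² ≤ H`.
  nlinarith [sq_nonneg (a * d - b * c),
    mul_le_mul_of_nonneg_right h3 (add_nonneg (mul_self_nonneg c) (mul_self_nonneg d))]

end DiscModel

/-! ### Boundedness of unit balls of positive definite forms. -/

section PositiveDefinite

set_option synthInstance.maxHeartbeats 200000 in
/-- The unit ball of a positive definite form on a finite-dimensional space is bounded. -/
theorem isVonNBounded_of_posDef {V : Type*} [NormedAddCommGroup V] [NormedSpace ℝ V]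
    [FiniteDimensional ℝ V] (B : V →L[ℝ] V →L[ℝ] ℝ) (hB : ∀ v, v ≠ 0 → 0 < B v v) :
    Bornology.IsVonNBounded ℝ {v : V | B v v < 1} := by
  rw [NormedSpace.isVonNBounded_iff]
  rcases (Metric.sphere (0 : V) 1).eq_empty_or_nonempty with hS | hS
  · have : ∀ v : V, v = 0 := by
      intro v
      by_contra hv
      have : (‖v‖⁻¹ • v) ∈ Metric.sphere (0 : V) 1 := by
        simp [norm_smul, inv_mul_cancel₀ (norm_ne_zero_iff.2 hv)]
      simp [hS] at this
    exact (Bornology.isBounded_singleton (x := (0 : V))).subset fun v _ ↦ this v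
  · have hc : ContinuousOn (fun v : V ↦ B v v) (Metric.sphere (0 : V) 1) := by fun_prop
    -- By homogeneity, the minimum `m` on the compact unit sphere gives `B v v ≥ m ‖v‖²`, whence the
    -- radius `√(1 / m)`.
    obtain ⟨v₀, hv₀, hmin⟩ := (isCompact_sphere (0 : V) 1).exists_isMinOn hS hc
    have hm : 0 < B v₀ v₀ := hB _ (by rintro rfl; simp at hv₀)
    refine (Metric.isBounded_closedBall (x := (0 : V)) (r := √(1 / B v₀ v₀))).subset fun v hv ↦ ?_
    rw [mem_closedBall_zero_iff]
    apply Real.le_sqrt_of_sq_le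
    rcases eq_or_ne v 0 with rfl | h0
    · simp [hm.le]
    · have hn : 0 < ‖v‖ := norm_pos_iff.2 h0
      have h1 : (‖v‖⁻¹ • v) ∈ Metric.sphere (0 : V) 1 := by
        simp [norm_smul, inv_mul_cancel₀ hn.ne']
      have h2 : B v₀ v₀ ≤ B (‖v‖⁻¹ • v) (‖v‖⁻¹ • v) := hmin h1
      have h3 : B (‖v‖⁻¹ • v) (‖v‖⁻¹ • v) = B v v / ‖v‖ ^ 2 := by
        simp; field_simp
      have h4 : B v v < 1 := hv
      rw [h3, le_div_iff₀ (by positivity)] at h2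
      rw [le_div_iff₀ hm]
      linarith

end PositiveDefinite

/-! ### Lipschitz estimates from bounds on the differential. -/

section Lipschitz

open Manifold MeasureTheory
open scoped ENNReal NNReal

variable {E : Type*} [NormedAddCommGroup E] [NormedSpace ℝ E] {H : Type*} [TopologicalSpace H]
  {I : ModelWithCorners ℝ E H} {X : Type*} [TopologicalSpace X] [ChartedSpace H X]
  {E' : Type*} [NormedAddCommGroup E'] [NormedSpace ℝ E'] {H' : Type*} [TopologicalSpace H']
  {I' : ModelWithCorners ℝ E' H'} {Y : Type*} [TopologicalSpace Y] [ChartedSpace H' Y]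
  [∀ x : X, ENorm (TangentSpace I x)] [∀ y : Y, ENorm (TangentSpace I' y)]

/-- A map whose differential is bounded by `C` is `C`-Lipschitz for the Riemannian distances. -/
theorem riemannianEDist_le_mul_of_enorm_mfderiv_le {f : X → Y} (hf : ContMDiff I I' 1 f) {C : ℝ≥0} (hC0 : C ≠ 0)
    (hC : ∀ (x : X) (v : TangentSpace I x), ‖mfderiv I I' f x v‖ₑ ≤ C * ‖v‖ₑ) (x y : X) :
    riemannianEDist I' (f x) (f y) ≤ C * riemannianEDist I x y := by
  have key : ∀ γ : Path x y, ContMDiff (𝓡∂ 1) I 1 γ → riemannianEDist I' (f x) (f y) ≤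
      C * ∫⁻ t, ‖mfderiv (𝓡∂ 1) I γ t 1‖ₑ := by
    intro γ hγ
    have hfc : Continuous f := hf.continuous
    have h1 : riemannianEDist I' (f x) (f y) ≤
        ∫⁻ t, ‖mfderiv (𝓡∂ 1) I' (γ.map hfc) t 1‖ₑ := by
      rw [riemannianEDist]
      exact iInf₂_le (γ.map hfc) (hf.comp hγ)
    refine h1.trans ?_
    rw [← lintegral_const_mul' _ _ ENNReal.coe_ne_top]
    refine lintegral_mono fun t ↦ ?_
    have h2 : mfderiv (𝓡∂ 1) I' (γ.map hfc) t =
        (mfderiv I I' f (γ t)).comp (mfderiv (𝓡∂ 1) I γ t) :=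
      mfderiv_comp t (hf.mdifferentiable one_ne_zero _) (hγ.mdifferentiable one_ne_zero t)
    rw [h2]
    exact hC _ _
  rw [riemannianEDist_def I x y]
  -- `C ≠ 0` matters here: with no path from `x` to `y` the infimum is `∞`, and `0 * ∞ = 0` would
  -- break the identity.
  simp_rw [ENNReal.mul_iInf_of_ne (ENNReal.coe_ne_zero.2 hC0) ENNReal.coe_ne_top]
  exact le_iInf₂ key

end Lipschitz

/-! ### Levi forms on manifolds with holomorphic charts. -/

section LeviSection

variable {V : Type*} [NormedAddCommGroup V] [NormedSpace ℂ V]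
variable {H : Type*} [TopologicalSpace H] (I : ModelWithCorners ℝ V H)
variable {X : Type*} [TopologicalSpace X] [ChartedSpace H X]

/-- The Levi form of `f` on the tangent space at `x`, computed in the preferred chart. -/
def leviFormAt (f : X → ℝ) (x : X) :
    TangentSpace I x →L[ℝ] TangentSpace I x →L[ℝ] ℝ :=
  (leviForm (f ∘ (extChartAt I x).symm) (extChartAt I x x) : V →L[ℝ] V →L[ℝ] ℝ)

/-- Since `i(iu) = -u`, the difference of Hessians in `√-1 ∂∂̄ f` becomes the sum defining the Levi
form. -/
theorem iddbar_eq_leviFormAt (f : X → ℝ) (x : X) (u v : TangentSpace I x) :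
    iddbar I f x u v = leviFormAt I f x (J I x u) v := by
  refine Eq.trans ?_ (leviForm_apply (V := V) _ _ _ _).symm
  have : Complex.I • (show V from J I x u) = -(show V from u) := by
    change Complex.I • Complex.I • (show V from u) = _
    rw [smul_smul, Complex.I_mul_I, neg_smul, one_smul]
  rw [this, map_neg, neg_apply, ← sub_eq_add_neg]
  rfl

/-- The transition maps between the preferred charts are holomorphic. -/
def HasHolomorphicCharts (X : Type*) [TopologicalSpace X] [ChartedSpace H X] : Prop :=
  ∀ x₀ x z : X, z ∈ (extChartAt I x₀).source → z ∈ (extChartAt I x).source →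
    ContDiffAt ℂ 2 (extChartAt I x ∘ (extChartAt I x₀).symm) (extChartAt I x₀ z)

variable [I.Boundaryless] [IsManifold I ∞ X]

theorem contDiffAt_comp_extChartAt_symm {f : X → ℝ} (hf : ContMDiff I 𝓘(ℝ, ℝ) ∞ f) (x₀ z : X)
    (hz : z ∈ (extChartAt I x₀).source) :
    ContDiffAt ℝ ∞ (f ∘ (extChartAt I x₀).symm) (extChartAt I x₀ z) := by
  rw [← contMDiffAt_iff_contDiffAt]
  have h1 := contMDiffOn_extChartAt_symm (I := I) (n := ∞) x₀
  exact hf.contMDiffAt.comp _ (h1.contMDiffAt (extChartAt_target_mem_nhds'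
    ((extChartAt I x₀).map_source hz)))

/-- The Levi form in another chart. -/
theorem leviForm_comp_extChartAt_symm (hX : HasHolomorphicCharts I X) {f : X → ℝ}
    (hf : ContMDiff I 𝓘(ℝ, ℝ) ∞ f) (x₀ x : X) (hx : x ∈ (extChartAt I x₀).source) (u v : V) :
    leviForm (f ∘ (extChartAt I x₀).symm) (extChartAt I x₀ x) u v =
      leviFormAt I f x (tangentCoordChange I x₀ x x u) (tangentCoordChange I x₀ x x v) := by
  have hs := extChartAt_source_mem_nhds (I := I) x
  have hol := hX x₀ x x hx (mem_extChartAt_source x)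
  have hd : tangentCoordChange I x₀ x x = (fderiv ℂ (extChartAt I x ∘ (extChartAt I x₀).symm)
      (extChartAt I x₀ x)).restrictScalars ℝ := by
    rw [tangentCoordChange_def, I.range_eq_univ, fderivWithin_univ]
    exact ((hol.differentiableAt (by simp)).hasFDerivAt.restrictScalars ℝ).fderiv
  have hφ : (extChartAt I x ∘ (extChartAt I x₀).symm) (extChartAt I x₀ x) = extChartAt I x x := by
    rw [Function.comp_apply, (extChartAt I x₀).left_inv hx]
  have h1 := leviForm_comp (f := f ∘ (extChartAt I x).symm) (by
    rw [hφ]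
    exact (contDiffAt_comp_extChartAt_symm I hf x x (mem_extChartAt_source x)).of_le
      ENat.LEInfty.out) hol u v
  rw [hφ] at h1
  rw [hd]
  refine Eq.trans ?_ h1
  refine congrArg (fun B : V →L[ℝ] V →L[ℝ] ℝ ↦ B u v) (leviForm_congr ?_)
  have hc : ContinuousAt (extChartAt I x₀).symm (extChartAt I x₀ x) :=
    continuousAt_extChartAt_symm' hx
  have hs' : (extChartAt I x).source ∈ 𝓝 ((extChartAt I x₀).symm (extChartAt I x₀ x)) := by
    rwa [(extChartAt I x₀).left_inv hx]
  filter_upwards [hc.preimage_mem_nhds hs'] with y hy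
  simp only [Function.comp_apply]
  rw [(extChartAt I x).left_inv hy]

/-- The Levi form of a smooth function is a smooth section. -/
theorem contMDiff_leviFormAt (hX : HasHolomorphicCharts I X) {f : X → ℝ}
    (hf : ContMDiff I 𝓘(ℝ, ℝ) ∞ f) :
    ContMDiff I (I.prod 𝓘(ℝ, V →L[ℝ] V →L[ℝ] ℝ)) ∞
      (fun x ↦ Bundle.TotalSpace.mk' (V →L[ℝ] V →L[ℝ] ℝ)
        (E := fun x : X ↦ TangentSpace I x →L[ℝ] TangentSpace I x →L[ℝ] ℝ)
        x (leviFormAt I f x)) := by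
  intro x₀
  rw [contMDiffAt_hom_bundle]
  refine ⟨contMDiffAt_id, ?_⟩
  -- `leviFormAt` uses a chart that varies with the point. Freezing the chart at `x₀` makes the
  -- coefficients visibly smooth; holomorphic naturality identifies them with the section in
  -- coordinates.
  have h1 : ContMDiffAt I 𝓘(ℝ, V →L[ℝ] V →L[ℝ] ℝ) ∞
      (fun x ↦ leviForm (f ∘ (extChartAt I x₀).symm) (extChartAt I x₀ x)) x₀ :=
    (leviForm_contDiffAt (contDiffAt_comp_extChartAt_symm I hf x₀ x₀
      (mem_extChartAt_source x₀))).contMDiffAt.comp x₀ contMDiffAt_extChartAt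
  refine h1.congr_of_eventuallyEq ?_
  filter_upwards [chart_source_mem_nhds H x₀] with x hx
  ext u v
  rw [leviForm_comp_extChartAt_symm I hX hf x₀ x (by simpa using hx)]
  have hb : x ∈ (trivializationAt V (TangentSpace I) x₀).baseSet := by simpa using hx
  refine (inCoordinates_apply_eq₂ (E₃ := fun _ : X ↦ ℝ) hb hb (Set.mem_univ _)).trans ?_
  have hs : ∀ w : V, (trivializationAt V (TangentSpace I) x₀).symm x w =
      tangentCoordChange I x₀ x x w := by
    intro w
    exact (Bundle.Trivialization.symmL_apply (R := ℝ) _ hb w).symm.trans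
      (congrArg (fun T : V →L[ℝ] V ↦ T w) (TangentBundle.symmL_trivializationAt_eq_core hx))
  rw [hs, hs]
  simp

end LeviSection

/-! ### Pullbacks of smooth bilinear forms. -/

section Pullback

variable {E : Type*} [NormedAddCommGroup E] [NormedSpace ℝ E] {H : Type*} [TopologicalSpace H]
  {I : ModelWithCorners ℝ E H} {X : Type*} [TopologicalSpace X] [ChartedSpace H X]
  {E' : Type*} [NormedAddCommGroup E'] [NormedSpace ℝ E'] {H' : Type*} [TopologicalSpace H']
  {I' : ModelWithCorners ℝ E' H'} {Y : Type*} [TopologicalSpace Y] [ChartedSpace H' Y]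

/-- The pullback of a bilinear form by a linear map. -/
def pullbackBilin (B : E' →L[ℝ] E' →L[ℝ] ℝ) (T : E →L[ℝ] E') : E →L[ℝ] E →L[ℝ] ℝ :=
  B.bilinearComp T T

set_option synthInstance.maxHeartbeats 200000 in
theorem contDiff_flip {A B : Type*} [NormedAddCommGroup A] [NormedSpace ℝ A]
    [NormedAddCommGroup B] [NormedSpace ℝ B] :
    ContDiff ℝ ∞ (ContinuousLinearMap.flip : (A →L[ℝ] B →L[ℝ] ℝ) → B →L[ℝ] A →L[ℝ] ℝ) :=
  IsBoundedLinearMap.contDiff ⟨⟨fun _ _ ↦ rfl, fun _ _ ↦ rfl⟩, 1, one_pos, fun x ↦ by simp⟩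

/-- Composition acts on the first slot only, so `T` is inserted, the slots are flipped, and both
operations are repeated. -/
theorem contMDiffAt_pullbackBilin {B : X → E' →L[ℝ] E' →L[ℝ] ℝ} {T : X → E →L[ℝ] E'} {x : X}
    (hB : ContMDiffAt I 𝓘(ℝ, E' →L[ℝ] E' →L[ℝ] ℝ) ∞ B x)
    (hT : ContMDiffAt I 𝓘(ℝ, E →L[ℝ] E') ∞ T x) :
    ContMDiffAt I 𝓘(ℝ, E →L[ℝ] E →L[ℝ] ℝ) ∞ (fun z ↦ pullbackBilin (B z) (T z)) x := by
  have h1 := (contDiff_flip (A := E) (B := E')).contMDiff.contMDiffAt.comp x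
    (hB.clm_comp hT)
  exact (contDiff_flip (A := E) (B := E)).contMDiff.contMDiffAt.comp x
    (h1.clm_comp hT)

/-- The pullback of a bilinear form on the tangent space by the differential of a map. -/
def pullbackForm (φ : X → Y)
    (B : ∀ y : Y, TangentSpace I' y →L[ℝ] TangentSpace I' y →L[ℝ] ℝ) (x : X) :
    TangentSpace I x →L[ℝ] TangentSpace I x →L[ℝ] ℝ :=
  (pullbackBilin (E := E) (E' := E') (B (φ x)) (mfderiv I I' φ x) : E →L[ℝ] E →L[ℝ] ℝ)

variable [IsManifold I ∞ X]

theorem contMDiff_sub_form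
    {B C : ∀ x : X, TangentSpace I x →L[ℝ] TangentSpace I x →L[ℝ] ℝ}
    (hB : ContMDiff I (I.prod 𝓘(ℝ, E →L[ℝ] E →L[ℝ] ℝ)) ∞
      (fun x ↦ Bundle.TotalSpace.mk' (E →L[ℝ] E →L[ℝ] ℝ)
        (E := fun x : X ↦ TangentSpace I x →L[ℝ] TangentSpace I x →L[ℝ] ℝ) x (B x)))
    (hC : ContMDiff I (I.prod 𝓘(ℝ, E →L[ℝ] E →L[ℝ] ℝ)) ∞
      (fun x ↦ Bundle.TotalSpace.mk' (E →L[ℝ] E →L[ℝ] ℝ)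
        (E := fun x : X ↦ TangentSpace I x →L[ℝ] TangentSpace I x →L[ℝ] ℝ) x (C x))) :
    ContMDiff I (I.prod 𝓘(ℝ, E →L[ℝ] E →L[ℝ] ℝ)) ∞
      (fun x ↦ Bundle.TotalSpace.mk' (E →L[ℝ] E →L[ℝ] ℝ)
        (E := fun x : X ↦ TangentSpace I x →L[ℝ] TangentSpace I x →L[ℝ] ℝ) x (B x - C x)) :=
  hB.sub_section hC

variable [IsManifold I' ∞ Y]

set_option synthInstance.maxHeartbeats 400000 in
/-- The pullback of a smooth field of bilinear forms is smooth. -/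
theorem contMDiff_pullbackForm {φ : X → Y} (hφ : ContMDiff I I' ∞ φ)
    {B : ∀ y : Y, TangentSpace I' y →L[ℝ] TangentSpace I' y →L[ℝ] ℝ}
    (hB : ContMDiff I' (I'.prod 𝓘(ℝ, E' →L[ℝ] E' →L[ℝ] ℝ)) ∞
      (fun y ↦ Bundle.TotalSpace.mk' (E' →L[ℝ] E' →L[ℝ] ℝ)
        (E := fun y : Y ↦ TangentSpace I' y →L[ℝ] TangentSpace I' y →L[ℝ] ℝ) y (B y))) :
    ContMDiff I (I.prod 𝓘(ℝ, E →L[ℝ] E →L[ℝ] ℝ)) ∞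
      (fun x ↦ Bundle.TotalSpace.mk' (E →L[ℝ] E →L[ℝ] ℝ)
        (E := fun x : X ↦ TangentSpace I x →L[ℝ] TangentSpace I x →L[ℝ] ℝ)
        x (pullbackForm (I := I) φ B x)) := by
  intro x₀
  rw [contMDiffAt_hom_bundle]
  refine ⟨contMDiffAt_id, ?_⟩
  have h1 := ((contMDiffAt_hom_bundle _).1 (hB (φ x₀))).2.comp x₀ hφ.contMDiffAt
  have h2 := (hφ x₀).mfderiv_const (m := ∞) (by simp)
  have h4 := contMDiffAt_pullbackBilin h1 h2
  refine h4.congr_of_eventuallyEq ?_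
  filter_upwards [chart_source_mem_nhds H x₀,
    hφ.continuous.continuousAt.preimage_mem_nhds (chart_source_mem_nhds H' (φ x₀))] with x hx hy
  ext u v
  have hb : x ∈ (trivializationAt E (TangentSpace I) x₀).baseSet := by simpa using hx
  have hb' : φ x ∈ (trivializationAt E' (TangentSpace I') (φ x₀)).baseSet := by simpa using hy
  refine (inCoordinates_apply_eq₂ (E₃ := fun _ : X ↦ ℝ) hb hb (Set.mem_univ _)).trans ?_
  have hT : ∀ w : E, inTangentCoordinates I I' id φ (mfderiv I I' φ) x₀ x w =
      (trivializationAt E' (TangentSpace I') (φ x₀)).continuousLinearMapAt ℝ (φ x)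
        (mfderiv I I' φ x ((trivializationAt E (TangentSpace I) x₀).symm x w)) := by
    intro w
    rw [← Bundle.Trivialization.symmL_apply (R := ℝ) _ hb w]
    rfl
  have h5 : ∀ w : E, (trivializationAt E' (TangentSpace I') (φ x₀)).symm (φ x)
      (inTangentCoordinates I I' id φ (mfderiv I I' φ) x₀ x w) =
        mfderiv I I' φ x ((trivializationAt E (TangentSpace I) x₀).symm x w) := by
    intro w
    rw [hT, ← Bundle.Trivialization.symmL_apply (R := ℝ) _ hb',
      Bundle.Trivialization.symmL_continuousLinearMapAt _ hb']
  have h6 := inCoordinates_apply_eq₂ (F₃ := ℝ) (E₃ := Bundle.Trivial Y ℝ) (ϕ := B (φ x))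
    (v := inTangentCoordinates I I' id φ (mfderiv I I' φ) x₀ x u)
    (w := inTangentCoordinates I I' id φ (mfderiv I I' φ) x₀ x v) hb' hb' trivial
  rw [h5, h5] at h6
  refine Eq.trans ?_ h6.symm
  simp [pullbackForm, pullbackBilin]
  rfl

end Pullback

/-! ### The disc bundle in charts and frames. -/

section DiscCharts

variable {E : Type*} [NormedAddCommGroup E] [NormedSpace ℂ E]
variable {M : Type*} [TopologicalSpace M] [ChartedSpace E M]
variable {L : M → Type*} [∀ x, AddCommGroup (L x)] [∀ x, Module ℂ (L x)]
  [∀ x, TopologicalSpace (L x)] [TopologicalSpace (Bundle.TotalSpace ℂ L)]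
  [FiberBundle ℂ L] [VectorBundle ℂ ℂ L]
variable (h : HermitianMetric E L)

namespace HermitianMetric

/-- The local weight `|e|_h²` in the preferred chart of the base. -/
def chartWeight (x : M) (z : E) : ℝ := h.localWeight x ((extChartAt 𝓘(ℝ, E) x).symm z)

theorem localWeight_pos {x z : M} (hz : z ∈ (trivializationAt ℂ L x).baseSet) :
    0 < h.localWeight x z := by
  refine h.pos _ _ fun h0 ↦ ?_
  have h1 := ((trivializationAt ℂ L x).continuousLinearEquivAt ℂ z hz).symm.injective.ne
    (one_ne_zero (α := ℂ))
  rw [map_zero] at h1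
  exact h1 h0

theorem dualNormSq_eq_div_localWeight {x : M} {v : DualTotal L}
    (hv : v.1 ∈ (trivializationAt ℂ L x).baseSet) :
    h.dualNormSq v =
      ‖(v.2 ((trivializationAt ℂ L x).symm v.1 1) : ℂ)‖ ^ 2 / h.localWeight x v.1 := by
  set e := trivializationAt ℂ L x
  refine h.dualNormSq_eq_of_frame v _ (fun h0 ↦ ?_) fun t ↦
    ⟨e.continuousLinearEquivAt ℂ v.1 hv t, ?_⟩
  · have h1 := (e.continuousLinearEquivAt ℂ v.1 hv).symm.injective.ne (one_ne_zero (α := ℂ))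
    rw [map_zero] at h1
    exact h1 h0
  · have h1 := (e.continuousLinearEquivAt ℂ v.1 hv).symm_apply_apply t
    have h2 : e.symm v.1 1 = (e.continuousLinearEquivAt ℂ v.1 hv).symm 1 := rfl
    rw [h2, ← map_smul, smul_eq_mul, mul_one, h1]

end HermitianMetric

/-- Evaluation at `1`, the linear coordinate on the dual of `ℂ`. -/
def evalOne : (ℂ →L[ℂ] ℂ) →L[ℂ] ℂ := ContinuousLinearMap.apply ℂ ℂ 1

@[simp] theorem evalOne_apply (w : ℂ →L[ℂ] ℂ) : evalOne w = w 1 := rfl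

theorem eq_zero_of_evalOne_eq_zero (w : ℂ →L[ℂ] ℂ) (hw : evalOne w = 0) : w = 0 := by
  ext
  simpa using hw

theorem extChartAt_disc_fst (p q : discBundle h) :
    (extChartAt (totalModel E) p q).1 = extChartAt 𝓘(ℝ, E) (discProj h p) (discProj h q) := rfl

/-- Only the trivialization of `L` restricts the fibre chart, because that of the trivial line
bundle is global. -/
theorem mem_extChartAt_disc_source (p q : discBundle h) :
    q ∈ (extChartAt (totalModel E) p).source ↔
      discProj h q ∈ (extChartAt 𝓘(ℝ, E) (discProj h p)).source ∧
        discProj h q ∈ (trivializationAt ℂ L (discProj h p)).baseSet := by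
  have h1 : q ∈ (extChartAt (totalModel E) p).source ↔
      q.1 ∈ (chartAt (ModelProd E (ℂ →L[ℂ] ℂ)) p.1).source := by
    rw [extChartAt_source, TopologicalSpace.Opens.chartAt_eq,
      OpenPartialHomeomorph.subtypeRestr_source]
    rfl
  rw [h1, FiberBundle.chartedSpace_chartAt, extChartAt_source]
  rw [OpenPartialHomeomorph.trans_source]
  simp only [Set.mem_inter_iff, OpenPartialHomeomorph.prod_source, Set.mem_preimage]
  simp [discProj]
  exact and_comm

theorem evalOne_extChartAt_disc_snd (p q : discBundle h)
    (hq : discProj h q ∈ (trivializationAt ℂ L (discProj h p)).baseSet) :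
    evalOne (extChartAt (totalModel E) p q).2 =
      q.1.2 ((trivializationAt ℂ L (discProj h p)).symm q.1.1 1) := by
  have h1 : (extChartAt (totalModel E) p q).2 = ContinuousLinearMap.inCoordinates ℂ L ℂ
      (Bundle.Trivial M ℂ) p.1.1 q.1.1 p.1.1 q.1.1 q.1.2 := rfl
  rw [h1, evalOne_apply, ContinuousLinearMap.inCoordinates]
  simp only [ContinuousLinearMap.comp_apply]
  rw [Bundle.Trivialization.continuousLinearMapAt_apply,
    Bundle.Trivialization.linearMapAt_apply,
    if_pos (show q.1.1 ∈ (trivializationAt ℂ (Bundle.Trivial M ℂ) p.1.1).baseSet from trivial)]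
  exact congrArg q.1.2 ((trivializationAt ℂ L (discProj h p)).symmL_apply (R := ℂ) hq (1 : ℂ))

theorem chartWeight_extChartAt {p q : discBundle h}
    (hq : q ∈ (extChartAt (totalModel E) p).source) :
    h.chartWeight (discProj h p) (extChartAt (totalModel E) p q).1 =
      h.localWeight (discProj h p) (discProj h q) := by
  rw [HermitianMetric.chartWeight, extChartAt_disc_fst,
    (extChartAt 𝓘(ℝ, E) _).left_inv ((mem_extChartAt_disc_source h p q).1 hq).1]

theorem chartWeight_pos {p q : discBundle h} (hq : q ∈ (extChartAt (totalModel E) p).source) :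
    0 < h.chartWeight (discProj h p) (extChartAt (totalModel E) p q).1 := by
  rw [chartWeight_extChartAt h hq]
  exact h.localWeight_pos ((mem_extChartAt_disc_source h p q).1 hq).2

theorem dualNormSq_eq_div_chartWeight {p q : discBundle h}
    (hq : q ∈ (extChartAt (totalModel E) p).source) :
    h.dualNormSq q.1 = ‖evalOne (extChartAt (totalModel E) p q).2‖ ^ 2 /
      h.chartWeight (discProj h p) (extChartAt (totalModel E) p q).1 := by
  have hb := ((mem_extChartAt_disc_source h p q).1 hq).2
  rw [chartWeight_extChartAt h hq, evalOne_extChartAt_disc_snd h p q hb]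
  exact h.dualNormSq_eq_div_localWeight hb

/-- From `|v|² = |w|² / H`. The disc condition thus becomes positivity of the potential. -/
theorem discPotential_eq {p q : discBundle h} (hq : q ∈ (extChartAt (totalModel E) p).source) :
    discPotential (h.chartWeight (discProj h p)) evalOne (extChartAt (totalModel E) p q) =
      h.chartWeight (discProj h p) (extChartAt (totalModel E) p q).1 *
        (1 - h.dualNormSq q.1) := by
  rw [discPotential, dualNormSq_eq_div_chartWeight h hq]
  have := chartWeight_pos h hq
  field_simp

theorem discPotential_pos {p q : discBundle h} (hq : q ∈ (extChartAt (totalModel E) p).source) :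
    0 < discPotential (h.chartWeight (discProj h p)) evalOne (extChartAt (totalModel E) p q) := by
  rw [discPotential_eq h hq]
  exact mul_pos (chartWeight_pos h hq) (sub_pos.2 q.2)

/-- The function `log (1 - |v|²)` on the disc bundle. -/
def logDefect (q : discBundle h) : ℝ := Real.log (1 - h.dualNormSq q.1)

/-- The function `log (1 - |w|² / H)` in a chart. -/
def chartLogDefect (x : M) (y : E × (ℂ →L[ℂ] ℂ)) : ℝ :=
  Real.log (discPotential (h.chartWeight x) evalOne y) - Real.log (h.chartWeight x y.1)

theorem logDefect_eq {p q : discBundle h} (hq : q ∈ (extChartAt (totalModel E) p).source) :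
    logDefect h q = chartLogDefect h (discProj h p) (extChartAt (totalModel E) p q) := by
  have h1 : 0 < 1 - h.dualNormSq q.1 := sub_pos.2 q.2
  rw [chartLogDefect, discPotential_eq h hq, Real.log_mul (chartWeight_pos h hq).ne' h1.ne',
    add_sub_cancel_left, logDefect]

theorem logDefect_comp_extChartAt_symm (p : discBundle h) :
    logDefect h ∘ (extChartAt (totalModel E) p).symm =ᶠ[𝓝 (extChartAt (totalModel E) p p)]
      chartLogDefect h (discProj h p) := by
  filter_upwards [extChartAt_target_mem_nhds (I := totalModel E) p] with y hy
  rw [Function.comp_apply, logDefect_eq h ((extChartAt (totalModel E) p).map_target hy),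
    (extChartAt (totalModel E) p).right_inv hy]

section Proj

theorem continuous_discProj : Continuous (discProj h) :=
  (FiberBundle.continuous_proj (ℂ →L[ℂ] ℂ)
    (fun x : M ↦ L x →L[ℂ] Bundle.Trivial M ℂ x)).comp continuous_subtype_val

theorem writtenInExtChartAt_discProj (p : discBundle h) :
    writtenInExtChartAt (totalModel E) 𝓘(ℝ, E) p (discProj h)
      =ᶠ[𝓝 (extChartAt (totalModel E) p p)] Prod.fst := by
  filter_upwards [extChartAt_target_mem_nhds (I := totalModel E) p] with y hy
  rw [writtenInExtChartAt, Function.comp_apply, Function.comp_apply, ← extChartAt_disc_fst,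
    (extChartAt (totalModel E) p).right_inv hy]

theorem contMDiff_discProj : ContMDiff (totalModel E) 𝓘(ℝ, E) ∞ (discProj h) := by
  intro p
  rw [contMDiffAt_iff]
  exact ⟨(continuous_discProj h).continuousAt,
    (contDiffAt_fst.congr_of_eventuallyEq (writtenInExtChartAt_discProj h p)).contDiffWithinAt⟩

theorem mfderiv_discProj (p : discBundle h) (u : TangentSpace (totalModel E) p) :
    mfderiv (totalModel E) 𝓘(ℝ, E) (discProj h) p u = (show E × (ℂ →L[ℂ] ℂ) from u).1 := by
  have h1 : HasMFDerivAt (totalModel E) 𝓘(ℝ, E) (discProj h) p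
      (ContinuousLinearMap.fst ℝ E (ℂ →L[ℂ] ℂ)) :=
    ⟨(continuous_discProj h).continuousAt, (hasFDerivAt_fst.congr_of_eventuallyEq
      (writtenInExtChartAt_discProj h p)).hasFDerivWithinAt⟩
  rw [h1.mfderiv]
  rfl

end Proj

section Smooth

omit [VectorBundle ℂ ℂ L] in
theorem contDiffAt_chartWeight [IsManifold 𝓘(ℂ, E) ω M] (x : M) :
    ContDiffAt ℝ ∞ (h.chartWeight x) (extChartAt 𝓘(ℝ, E) x x) := by
  set e := trivializationAt ℂ L x with he
  set z₀ := extChartAt 𝓘(ℝ, E) x x with hz₀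
  let b : E → M := (extChartAt 𝓘(ℝ, E) x).symm
  -- The local frame is smooth because its fibre coordinate is constantly `1`; the weight is its
  -- squared norm.
  let s : E → Bundle.TotalSpace ℂ L := fun z ↦ ⟨b z, e.symm (b z) 1⟩
  have hb₀ : b z₀ = x := (extChartAt 𝓘(ℝ, E) x).left_inv (mem_extChartAt_source x)
  have hb : ContMDiffAt 𝓘(ℝ, E) 𝓘(ℝ, E) ∞ b z₀ :=
    (contMDiffOn_extChartAt_symm (I := 𝓘(ℝ, E)) (n := ∞) x).contMDiffAt
      (extChartAt_target_mem_nhds x)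
  have hs : ContMDiffAt 𝓘(ℝ, E) (𝓘(ℝ, E).prod 𝓘(ℝ, ℂ)) ∞ s z₀ := by
    rw [Bundle.contMDiffAt_totalSpace]
    refine ⟨hb, ?_⟩
    have h1 : (s z₀).proj = x := hb₀
    rw [h1]
    refine (contMDiffAt_const (c := (1 : ℂ))).congr_of_eventuallyEq ?_
    have h2 : e.baseSet ∈ 𝓝 (b z₀) := by
      rw [hb₀]
      exact e.open_baseSet.mem_nhds (FiberBundle.mem_baseSet_trivializationAt' x)
    filter_upwards [hb.continuousAt.preimage_mem_nhds h2] with z hz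
    exact congrArg Prod.snd (e.apply_mk_symm hz (1 : ℂ))
  rw [← contMDiffAt_iff_contDiffAt]
  exact h.smooth.contMDiffAt.comp z₀ hs

variable [IsManifold 𝓘(ℂ, E) ω M]

theorem contDiffAt_log_chartWeight (x : M) :
    ContDiffAt ℝ ∞ (fun z ↦ Real.log (h.chartWeight x z)) (extChartAt 𝓘(ℝ, E) x x) := by
  refine (contDiffAt_chartWeight h x).log ?_
  rw [HermitianMetric.chartWeight, (extChartAt 𝓘(ℝ, E) x).left_inv (mem_extChartAt_source x)]
  exact (h.localWeight_pos (FiberBundle.mem_baseSet_trivializationAt' x)).ne'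

theorem contDiffAt_log_discPotential (p : discBundle h) :
    ContDiffAt ℝ ∞ (fun y ↦ Real.log (discPotential (h.chartWeight (discProj h p)) evalOne y))
      (extChartAt (totalModel E) p p) :=
  (contDiffAt_discPotential (contDiffAt_chartWeight h (discProj h p))).log
    (discPotential_pos h (mem_extChartAt_source p)).ne'

theorem contDiffAt_chartLogDefect (p : discBundle h) :
    ContDiffAt ℝ ∞ (chartLogDefect h (discProj h p)) (extChartAt (totalModel E) p p) :=
  (contDiffAt_log_discPotential h p).sub
    (ContDiffAt.comp (extChartAt (totalModel E) p p)
      (g := fun z ↦ Real.log (h.chartWeight (discProj h p) z))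
      (contDiffAt_log_chartWeight h (discProj h p)) contDiffAt_fst)

theorem contMDiff_logDefect : ContMDiff (totalModel E) 𝓘(ℝ, ℝ) ∞ (logDefect h) := by
  intro p
  have h1 := (contDiffAt_chartLogDefect h p).contMDiffAt.comp p
    (contMDiffAt_extChartAt (I := totalModel E) (n := ∞) (x := p))
  refine h1.congr_of_eventuallyEq ?_
  filter_upwards [extChartAt_source_mem_nhds (I := totalModel E) p] with q hq
  exact logDefect_eq h hq

variable [ContMDiffVectorBundle ω ℂ L 𝓘(ℂ, E)]

/-- The real and complex models have the same charts as maps, and the complex transition maps are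
analytic because `L` is a holomorphic bundle. -/
theorem hasHolomorphicCharts_discBundle :
    HasHolomorphicCharts (totalModel E) (discBundle h) := by
  intro x₀ x z hx₀ hx
  have h1 := contDiffWithinAt_ext_coord_change (I := 𝓘(ℂ, E).prod 𝓘(ℂ, ℂ →L[ℂ] ℂ)) (n := ω) x x₀
    (y := extChartAt (totalModel E) x₀ z) (by
      rw [PartialEquiv.trans_source]
      refine ⟨(extChartAt (totalModel E) x₀).map_source hx₀, ?_⟩
      change (extChartAt (totalModel E) x₀).symm (extChartAt (totalModel E) x₀ z) ∈
        (extChartAt (totalModel E) x).source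
      rwa [(extChartAt (totalModel E) x₀).left_inv hx₀])
  rw [ModelWithCorners.Boundaryless.range_eq_univ, contDiffWithinAt_univ] at h1
  exact h1.of_le le_top

end Smooth

end DiscCharts

/-! ### The Hermitian metric of the disc bundle. -/

section DiscMetric

variable {E : Type*} [NormedAddCommGroup E] [NormedSpace ℂ E]
variable {M : Type*} [TopologicalSpace M] [ChartedSpace E M] [IsManifold 𝓘(ℂ, E) ω M]
variable {L : M → Type*} [∀ x, AddCommGroup (L x)] [∀ x, Module ℂ (L x)]
  [∀ x, TopologicalSpace (L x)] [TopologicalSpace (Bundle.TotalSpace ℂ L)]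
  [FiberBundle ℂ L] [VectorBundle ℂ ℂ L]
variable (h : HermitianMetric E L)
  (gM : Bundle.ContMDiffRiemannianMetric 𝓘(ℝ, E) ∞ E (fun x : M ↦ TangentSpace 𝓘(ℝ, E) x))

omit [VectorBundle ℂ ℂ L] in
/-- The base metric is the Levi form of the logarithm of the local weight. -/
theorem inner_eq_neg_leviForm (hM : IsHermitianWithForm 𝓘(ℝ, E) gM h.curvatureForm) (x : M)
    (u v : E) : gM.inner x u v =
      -leviForm (fun z ↦ Real.log (h.chartWeight x z)) (extChartAt 𝓘(ℝ, E) x x) u v := by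
  -- Chosen so that `J w = u`, which inverts `Ω(w, v) = g(J w, v)`.
  let w : TangentSpace 𝓘(ℝ, E) x := (-(Complex.I • u) : E)
  have h2 : J 𝓘(ℝ, E) x w = u := by
    change Complex.I • (-(Complex.I • u)) = u
    rw [smul_neg, smul_smul, Complex.I_mul_I, neg_smul, one_smul, neg_neg]
  have h3 : h.curvatureForm x w v =
      -leviFormAt 𝓘(ℝ, E) (fun z ↦ Real.log (h.localWeight x z)) x (J 𝓘(ℝ, E) x w) v :=
    congrArg Neg.neg (iddbar_eq_leviFormAt _ _ _ _ _)
  have h4 := (hM x w v).2.symm.trans h3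
  rw [h2] at h4
  exact h4

/-- The metric of the disc bundle as a field of bilinear forms. -/
def discInner (p : discBundle h) :
    TangentSpace (totalModel E) p →L[ℝ] TangentSpace (totalModel E) p →L[ℝ] ℝ :=
  pullbackForm (I := totalModel E) (discProj h) gM.inner p -
    leviFormAt (totalModel E) (logDefect h) p

theorem discInner_apply (p : discBundle h) (u v : E × (ℂ →L[ℂ] ℂ)) :
    discInner h gM p u v = gM.inner (discProj h p) (show E from u.1) (show E from v.1) -
      leviForm (chartLogDefect h (discProj h p)) (extChartAt (totalModel E) p p) u v := by
  have h1 : leviFormAt (totalModel E) (logDefect h) p =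
      (leviForm (chartLogDefect h (discProj h p)) (extChartAt (totalModel E) p p) : _ →L[ℝ] _) :=
    leviForm_congr (logDefect_comp_extChartAt_symm h p)
  rw [discInner, h1]
  refine congrArg (fun t : ℝ ↦ t - _) ?_
  refine Eq.trans (b := gM.inner (discProj h p)
    (mfderiv (totalModel E) 𝓘(ℝ, E) (discProj h) p u)
    (mfderiv (totalModel E) 𝓘(ℝ, E) (discProj h) p v)) rfl ?_
  exact congrArg₂ (fun a b : E ↦ gM.inner (discProj h p) a b) (mfderiv_discProj h p u)
    (mfderiv_discProj h p v)

/-- The two copies of `log H`, one from the base metric and one from `log (1 - |w|² / H)`, cancel.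
-/
theorem discInner_self (hM : IsHermitianWithForm 𝓘(ℝ, E) gM h.curvatureForm) (p : discBundle h)
    (u : E × (ℂ →L[ℂ] ℂ)) : discInner h gM p u u =
      -leviForm (fun y ↦ Real.log (discPotential (h.chartWeight (discProj h p)) evalOne y))
        (extChartAt (totalModel E) p p) u u := by
  have hH := contDiffAt_log_chartWeight h (discProj h p)
  have hH' : ContDiffAt ℝ ∞ (fun y : E × (ℂ →L[ℂ] ℂ) ↦
      Real.log (h.chartWeight (discProj h p) y.1)) (extChartAt (totalModel E) p p) :=
    ContDiffAt.comp (extChartAt (totalModel E) p p)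
      (g := fun z ↦ Real.log (h.chartWeight (discProj h p) z)) hH contDiffAt_fst
  have h1 := leviForm_sub ((contDiffAt_log_discPotential h p).of_le ENat.LEInfty.out)
    (hH'.of_le ENat.LEInfty.out)
  have h2 := leviForm_comp_fst (y := extChartAt (totalModel E) p p)
    (f := fun z ↦ Real.log (h.chartWeight (discProj h p) z)) (hH.of_le ENat.LEInfty.out) u u
  rw [discInner_apply, inner_eq_neg_leviForm h gM hM]
  unfold chartLogDefect
  rw [h1, sub_apply, sub_apply, h2]
  simp only [extChartAt_disc_fst]
  ring

theorem inner_self_nonneg (x : M) (v : E) : 0 ≤ gM.inner x (show E from v) (show E from v) := by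
  rcases eq_or_ne v 0 with rfl | hv
  · exact (map_zero _).ge
  · exact (gM.pos x v hv).le

theorem contDiffAt_two_chartWeight (p : discBundle h) :
    ContDiffAt ℝ 2 (h.chartWeight (discProj h p)) (extChartAt (totalModel E) p p).1 :=
  (contDiffAt_chartWeight h (discProj h p)).of_le ENat.LEInfty.out

theorem discInner_pos (hM : IsHermitianWithForm 𝓘(ℝ, E) gM h.curvatureForm) (p : discBundle h)
    (u : E × (ℂ →L[ℂ] ℂ)) (hu : u ≠ 0) : 0 < discInner h gM p u u := by
  rw [discInner_self h gM hM]
  refine leviForm_log_discPotential_pos (contDiffAt_two_chartWeight h p)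
    (chartWeight_pos h (mem_extChartAt_source p)) (discPotential_pos h (mem_extChartAt_source p))
    eq_zero_of_evalOne_eq_zero u hu fun v hv ↦ ?_
  have h1 := gM.pos (discProj h p) v hv
  rwa [inner_eq_neg_leviForm h gM hM] at h1

theorem inner_le_discInner (hM : IsHermitianWithForm 𝓘(ℝ, E) gM h.curvatureForm)
    (p : discBundle h) (u : E × (ℂ →L[ℂ] ℂ)) :
    gM.inner (discProj h p) (show E from u.1) (show E from u.1) ≤ discInner h gM p u u := by
  have h1 := inner_self_nonneg gM (discProj h p) u.1
  rw [discInner_self h gM hM]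
  rw [inner_eq_neg_leviForm h gM hM] at h1 ⊢
  exact leviForm_le_leviForm_log_discPotential (contDiffAt_two_chartWeight h p)
    (chartWeight_pos h (mem_extChartAt_source p)) (discPotential_pos h (mem_extChartAt_source p))
    u h1

theorem sq_fderiv_chartLogDefect_le (hM : IsHermitianWithForm 𝓘(ℝ, E) gM h.curvatureForm)
    (p : discBundle h) (u : E × (ℂ →L[ℂ] ℂ)) :
    fderiv ℝ (chartLogDefect h (discProj h p)) (extChartAt (totalModel E) p p) u ^ 2 ≤
      2 * discInner h gM p u u := by
  have h1 := inner_self_nonneg gM (discProj h p) u.1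
  rw [discInner_self h gM hM]
  rw [inner_eq_neg_leviForm h gM hM] at h1
  have h2 := sq_fderiv_log_sub_log_le (contDiffAt_two_chartWeight h p)
    (chartWeight_pos h (mem_extChartAt_source p)) (discPotential_pos h (mem_extChartAt_source p))
    u h1
  have h3 : chartLogDefect h (discProj h p) = fun y ↦ -(Real.log (h.chartWeight (discProj h p) y.1)
      - Real.log (discPotential (h.chartWeight (discProj h p)) evalOne y)) := by
    funext y
    rw [chartLogDefect]
    ring
  rw [h3, fderiv_fun_neg, neg_apply, neg_sq]
  exact h2

theorem sq_mfderiv_logDefect_le (hM : IsHermitianWithForm 𝓘(ℝ, E) gM h.curvatureForm)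
    (p : discBundle h) (u : TangentSpace (totalModel E) p) :
    (show ℝ from mfderiv (totalModel E) 𝓘(ℝ, ℝ) (logDefect h) p u) ^ 2 ≤
      2 * discInner h gM p u u := by
  have h1 : mfderiv (totalModel E) 𝓘(ℝ, ℝ) (logDefect h) p =
      fderiv ℝ (chartLogDefect h (discProj h p)) (extChartAt (totalModel E) p p) := by
    rw [((contMDiff_logDefect h).mdifferentiable (by simp) p).mfderiv,
      ModelWithCorners.Boundaryless.range_eq_univ, fderivWithin_univ]
    exact (logDefect_comp_extChartAt_symm h p).fderiv_eq
  rw [h1]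
  exact sq_fderiv_chartLogDefect_le h gM hM p u

variable [ContMDiffVectorBundle ω ℂ L 𝓘(ℂ, E)]

variable [FiniteDimensional ℂ E]

/-- The metric of the disc bundle. -/
def discMetric (hM : IsHermitianWithForm 𝓘(ℝ, E) gM h.curvatureForm) :
    Bundle.ContMDiffRiemannianMetric (totalModel E) ∞ (E × (ℂ →L[ℂ] ℂ))
      (fun p : discBundle h ↦ TangentSpace (totalModel E) p) where
  inner := discInner h gM
  symm p u v := by
    have h1 := gM.symm (discProj h p) (show E × (ℂ →L[ℂ] ℂ) from u).1
      (show E × (ℂ →L[ℂ] ℂ) from v).1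
    have h2 := leviForm_symm ((contDiffAt_chartLogDefect h p).of_le ENat.LEInfty.out)
      (show E × (ℂ →L[ℂ] ℂ) from u) (show E × (ℂ →L[ℂ] ℂ) from v)
    exact (discInner_apply h gM p u v).trans
      ((congrArg₂ (fun s t : ℝ ↦ s - t) h1 h2).trans (discInner_apply h gM p v u).symm)
  pos p u hu := discInner_pos h gM hM p u hu
  isVonNBounded p := by
    have : FiniteDimensional ℝ E := FiniteDimensional.complexToReal E
    exact isVonNBounded_of_posDef (V := E × (ℂ →L[ℂ] ℂ)) (discInner h gM p)
      (discInner_pos h gM hM p)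
  contMDiff := contMDiff_sub_form (contMDiff_pullbackForm (contMDiff_discProj h) gM.contMDiff)
    (contMDiff_leviFormAt (totalModel E) (hasHolomorphicCharts_discBundle h)
      (contMDiff_logDefect h))

theorem isHermitianWithForm_discMetric (hM : IsHermitianWithForm 𝓘(ℝ, E) gM h.curvatureForm) :
    IsHermitianWithForm (totalModel E) (discMetric h gM hM) (discForm h) := by
  intro p u v
  constructor
  · refine (discInner_apply h gM p (Complex.I • (show E × (ℂ →L[ℂ] ℂ) from u))
      (Complex.I • (show E × (ℂ →L[ℂ] ℂ) from v))).trans ?_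
    refine Eq.trans ?_ (discInner_apply h gM p u v).symm
    exact congrArg₂ (fun s t : ℝ ↦ s - t) (hM (discProj h p) (show E × (ℂ →L[ℂ] ℂ) from u).1
      (show E × (ℂ →L[ℂ] ℂ) from v).1).1 (leviForm_I_smul _ _ _ _)
  · rw [discForm, iddbar_eq_leviFormAt, (hM _ _ _).2]
    refine congrArg (fun t : ℝ ↦ t - _) ?_
    refine Eq.trans ?_ (Eq.refl (gM.inner (discProj h p)
      (mfderiv (totalModel E) 𝓘(ℝ, E) (discProj h) p (J (totalModel E) p u))
      (mfderiv (totalModel E) 𝓘(ℝ, E) (discProj h) p v)))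
    rw [mfderiv_discProj, mfderiv_discProj, mfderiv_discProj]
    rfl

end DiscMetric

/-! ### Distances of Riemannian metrics and the manifold topology. -/

section MetricDist

open Filter

variable {V : Type*} [NormedAddCommGroup V] [NormedSpace ℂ V]
variable {H : Type*} [TopologicalSpace H] {I : ModelWithCorners ℝ V H}
variable {X : Type*} [TopologicalSpace X] [ChartedSpace H X] [IsManifold I ∞ X]
variable {V' : Type*} [NormedAddCommGroup V'] [NormedSpace ℂ V']
variable {H' : Type*} [TopologicalSpace H'] {I' : ModelWithCorners ℝ V' H'}
variable {Y : Type*} [TopologicalSpace Y] [ChartedSpace H' Y] [IsManifold I' ∞ Y]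
variable (g : Bundle.ContMDiffRiemannianMetric I ∞ V (fun x : X ↦ TangentSpace I x))
variable (g' : Bundle.ContMDiffRiemannianMetric I' ∞ V' (fun y : Y ↦ TangentSpace I' y))

theorem enorm_tangentSpace (x : X) (v : TangentSpace I x) :
    letI : Bundle.RiemannianBundle (fun x : X ↦ TangentSpace I x) := ⟨g.toRiemannianMetric⟩
    ‖v‖ₑ = ENNReal.ofReal √(g.inner x v v) := by
  let _ : Bundle.RiemannianBundle (fun x : X ↦ TangentSpace I x) := ⟨g.toRiemannianMetric⟩
  rw [← ofReal_norm, norm_eq_sqrt_real_inner]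
  rfl

theorem metricDist_comm (x y : X) : metricDist I g x y = metricDist I g y x :=
  letI : Bundle.RiemannianBundle (fun x : X ↦ TangentSpace I x) := ⟨g.toRiemannianMetric⟩
  Manifold.riemannianEDist_comm

theorem metricDist_triangle (x y z : X) :
    metricDist I g x z ≤ metricDist I g x y + metricDist I g y z :=
  letI : Bundle.RiemannianBundle (fun x : X ↦ TangentSpace I x) := ⟨g.toRiemannianMetric⟩
  haveI : IsManifold I 1 X := IsManifold.of_le (n := ∞) ENat.LEInfty.out
  Manifold.riemannianEDist_triangle

theorem eventually_metricDist_lt (x : X) {c : ENNReal} (hc : 0 < c) :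
    ∀ᶠ y in 𝓝 x, metricDist I g x y < c := by
  let _ : Bundle.RiemannianBundle (fun x : X ↦ TangentSpace I x) := ⟨g.toRiemannianMetric⟩
  have : IsManifold I 1 X := IsManifold.of_le (n := ∞) ENat.LEInfty.out
  have : IsContinuousRiemannianBundle V (fun x : X ↦ TangentSpace I x) :=
    ⟨⟨g.inner, g.contMDiff.continuous, fun _ _ _ ↦ rfl⟩⟩
  exact eventually_riemannianEDist_lt I x hc

theorem exists_metricDist_lt_subset [RegularSpace X] {x : X} {s : Set X} (hs : s ∈ 𝓝 x) :
    ∃ c > 0, {y | metricDist I g x y < c} ⊆ s := by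
  let _ : Bundle.RiemannianBundle (fun x : X ↦ TangentSpace I x) := ⟨g.toRiemannianMetric⟩
  have : IsManifold I 1 X := IsManifold.of_le (n := ∞) ENat.LEInfty.out
  have : IsContinuousRiemannianBundle V (fun x : X ↦ TangentSpace I x) :=
    ⟨⟨g.inner, g.contMDiff.continuous, fun _ _ _ ↦ rfl⟩⟩
  exact setOfPred_riemannianEDist_lt_subset_nhds' I hs

theorem tendsto_of_tendsto_metricDist [RegularSpace X] {a : ℕ → X} {x : X}
    (ha : Tendsto (fun j ↦ metricDist I g (a j) x) atTop (𝓝 0)) : Tendsto a atTop (𝓝 x) := by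
  intro s hs
  obtain ⟨c, hc, hcs⟩ := exists_metricDist_lt_subset g hs
  rw [mem_map]
  filter_upwards [(tendsto_order.1 ha).2 c hc] with j hj
  exact hcs (by rwa [metricDist_comm] at hj)

/-- A Cauchy sequence with a topologically convergent subsequence converges for the distance. -/
theorem tendsto_metricDist_of_subseq {a : ℕ → X}
    (ha : ∀ ε : ENNReal, 0 < ε → ∃ N, ∀ j ≥ N, ∀ k ≥ N, metricDist I g (a j) (a k) < ε)
    {φ : ℕ → ℕ} (hφ : StrictMono φ) {x : X} (hx : Tendsto (a ∘ φ) atTop (𝓝 x)) :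
    Tendsto (fun j ↦ metricDist I g (a j) x) atTop (𝓝 0) := by
  rw [ENNReal.tendsto_nhds_zero]
  intro ε hε
  obtain ⟨N, hN⟩ := ha (ε / 2) (ENNReal.half_pos hε.ne')
  obtain ⟨k, hk, hkN⟩ := ((hx.eventually (eventually_metricDist_lt g x
    (ENNReal.half_pos hε.ne'))).and (hφ.tendsto_atTop.eventually_ge_atTop N)).exists
  filter_upwards [eventually_ge_atTop N] with j hj
  rw [metricDist_comm] at hk
  exact (metricDist_triangle g _ (a (φ k)) _).trans
    ((add_le_add (hN j hj _ hkN).le hk.le).trans_eq (ENNReal.add_halves ε))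

/-- A smooth map that does not increase the metric does not increase distances. -/
theorem metricDist_map_le {φ : X → Y} (hφ : ContMDiff I I' ∞ φ)
    (hle : ∀ (x : X) (v : TangentSpace I x),
      g'.inner (φ x) (mfderiv I I' φ x v) (mfderiv I I' φ x v) ≤ g.inner x v v) (x y : X) :
    metricDist I' g' (φ x) (φ y) ≤ metricDist I g x y := by
  let _ : Bundle.RiemannianBundle (fun x : X ↦ TangentSpace I x) := ⟨g.toRiemannianMetric⟩
  let _ : Bundle.RiemannianBundle (fun y : Y ↦ TangentSpace I' y) := ⟨g'.toRiemannianMetric⟩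
  have h1 := riemannianEDist_le_mul_of_enorm_mfderiv_le (C := 1)
    (hφ.of_le ENat.LEInfty.out) one_ne_zero (fun x v ↦ by
      rw [enorm_tangentSpace g, enorm_tangentSpace g', ENNReal.coe_one, one_mul]
      exact ENNReal.ofReal_le_ofReal (Real.sqrt_le_sqrt (hle x v))) x y
  rwa [ENNReal.coe_one, one_mul] at h1

/-- A smooth function with bounded differential is Lipschitz. -/
theorem edist_map_le {f : X → ℝ} (hf : ContMDiff I 𝓘(ℝ, ℝ) ∞ f) {C : NNReal} (hC : C ≠ 0)
    (hle : ∀ (x : X) (v : TangentSpace I x),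
      (show ℝ from mfderiv I 𝓘(ℝ, ℝ) f x v) ^ 2 ≤ C ^ 2 * g.inner x v v) (x y : X) :
    edist (f x) (f y) ≤ C * metricDist I g x y := by
  let _ : Bundle.RiemannianBundle (fun x : X ↦ TangentSpace I x) := ⟨g.toRiemannianMetric⟩
  -- The usual distance of `ℝ` is its Riemannian distance, so the general Lipschitz estimate
  -- applies.
  rw [IsRiemannianManifold.out (I := 𝓘(ℝ, ℝ)) (f x) (f y)]
  refine riemannianEDist_le_mul_of_enorm_mfderiv_le (hf.of_le ENat.LEInfty.out) hC
    (fun x v ↦ ?_) x y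
  have h1 : ‖mfderiv I 𝓘(ℝ, ℝ) f x v‖ₑ =
      ENNReal.ofReal |(show ℝ from mfderiv I 𝓘(ℝ, ℝ) f x v)| :=
    enorm_tangentSpace_vectorSpace.trans (Real.enorm_eq_ofReal_abs _)
  have h2 : ∀ t G : ℝ, t ^ 2 ≤ C ^ 2 * G → ENNReal.ofReal |t| ≤ C * ENNReal.ofReal √G := by
    intro t G ht
    rw [← ENNReal.ofReal_coe_nnreal, ← ENNReal.ofReal_mul C.coe_nonneg]
    refine ENNReal.ofReal_le_ofReal ((Real.abs_le_sqrt ht).trans_eq ?_)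
    rw [Real.sqrt_mul (sq_nonneg _), Real.sqrt_sq C.coe_nonneg]
  rw [enorm_tangentSpace g, h1]
  exact h2 _ _ (hle x v)

end MetricDist

/-! ### Completeness of the disc bundle. -/

section Completeness

open Filter

variable {E : Type*} [NormedAddCommGroup E] [NormedSpace ℂ E]
variable {M : Type*} [TopologicalSpace M] [ChartedSpace E M] [IsManifold 𝓘(ℂ, E) ω M]
variable {L : M → Type*} [∀ x, AddCommGroup (L x)] [∀ x, Module ℂ (L x)]
  [∀ x, TopologicalSpace (L x)] [TopologicalSpace (Bundle.TotalSpace ℂ L)]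
  [FiberBundle ℂ L] [VectorBundle ℂ ℂ L]
variable (h : HermitianMetric E L)

/-- The zero section of the disc bundle. -/
def discZero (x : M) : discBundle h :=
  ⟨⟨x, 0⟩, by
    change h.dualNormSq ⟨x, 0⟩ < 1
    simp [HermitianMetric.dualNormSq]⟩

theorem norm_eq_norm_evalOne (w : ℂ →L[ℂ] ℂ) : ‖w‖ = ‖evalOne w‖ := by
  refine le_antisymm (w.opNorm_le_bound (norm_nonneg _) fun z ↦ ?_) ?_
  · have : w z = z * w 1 := by rw [← smul_eq_mul, ← map_smul, smul_eq_mul, mul_one]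
    rw [this, norm_mul, mul_comm, evalOne_apply]
  · simpa using w.le_opNorm 1

/-- A sequence in the disc bundle that stays away from the boundary and whose projection converges
has a convergent subsequence. -/
theorem exists_subseq_tendsto {a : ℕ → discBundle h} {p₀ : discBundle h}
    (hx : Tendsto (fun j ↦ discProj h (a j)) atTop (𝓝 (discProj h p₀))) {c : ℝ} (hc : c < 1)
    (ha : ∀ᶠ j in atTop, h.dualNormSq (a j).1 ≤ c) :
    ∃ (p : discBundle h) (φ : ℕ → ℕ), StrictMono φ ∧ Tendsto (a ∘ φ) atTop (𝓝 p) := by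
  set x := discProj h p₀
  set T := trivializationAt (ℂ →L[ℂ] ℂ) (fun x : M ↦ L x →L[ℂ] Bundle.Trivial M ℂ x) x
  let W : ℕ → ℂ →L[ℂ] ℂ := fun j ↦ (T (a j).1).2
  have hxT : x ∈ T.baseSet := FiberBundle.mem_baseSet_trivializationAt' x
  have hWt : ∀ᶠ j in atTop, h.chartWeight x (extChartAt 𝓘(ℝ, E) x (discProj h (a j))) ≤
      h.chartWeight x (extChartAt 𝓘(ℝ, E) x x) + 1 := by
    have h1 := (contDiffAt_chartWeight h x).continuousAt.tendsto.comp
      ((continuousAt_extChartAt (I := 𝓘(ℝ, E)) x).tendsto.comp hx)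
    exact (h1.eventually_lt_const (lt_add_one _)).mono fun _ hj ↦ hj.le
  have hsrc : ∀ᶠ j in atTop, a j ∈ (extChartAt (totalModel E) p₀).source := by
    filter_upwards [hx (extChartAt_source_mem_nhds (I := 𝓘(ℝ, E)) x),
      hx ((trivializationAt ℂ L x).open_baseSet.mem_nhds
        (FiberBundle.mem_baseSet_trivializationAt' x))] with j h1 h2
    exact (mem_extChartAt_disc_source h p₀ (a j)).2 ⟨h1, h2⟩
  -- `|w|² = |v|² H < H`, and `H` along the projections is eventually at most its limit plus `1`.
  have hW : ∀ᶠ j in atTop, W j ∈ Metric.closedBall (0 : ℂ →L[ℂ] ℂ)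
      √(h.chartWeight x (extChartAt 𝓘(ℝ, E) x x) + 1) := by
    filter_upwards [hWt, hsrc] with j h1 h2
    rw [mem_closedBall_zero_iff, norm_eq_norm_evalOne]
    refine Real.le_sqrt_of_sq_le (le_trans ?_ h1)
    have h3 : h.dualNormSq (a j).1 = ‖evalOne (W j)‖ ^ 2 /
        h.chartWeight x (extChartAt 𝓘(ℝ, E) x (discProj h (a j))) :=
      dualNormSq_eq_div_chartWeight h h2
    have h4 : 0 < h.chartWeight x (extChartAt 𝓘(ℝ, E) x (discProj h (a j))) :=
      chartWeight_pos h h2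
    have h5 : h.dualNormSq (a j).1 < 1 := (a j).2
    rw [h3, div_lt_one h4] at h5
    exact h5.le
  have : ProperSpace (ℂ →L[ℂ] ℂ) := FiniteDimensional.proper ℂ _
  obtain ⟨w, -, φ, hφ, hw⟩ := tendsto_subseq_of_frequently_bounded Metric.isBounded_closedBall
    hW.frequently
  have hpair : Tendsto (fun j ↦ (discProj h (a (φ j)), W (φ j))) atTop (𝓝 (x, w)) :=
    (hx.comp hφ.tendsto_atTop).prodMk_nhds hw
  have hsymm : ContinuousAt T.toOpenPartialHomeomorph.symm (x, w) :=
    T.toOpenPartialHomeomorph.continuousAt_symm (T.mem_target.2 hxT)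
  have hlim : Tendsto (fun j ↦ (a (φ j)).1) atTop
      (𝓝 (T.toOpenPartialHomeomorph.symm (x, w))) := by
    refine (hsymm.tendsto.comp hpair).congr' ?_
    filter_upwards [(hx.comp hφ.tendsto_atTop) (T.open_baseSet.mem_nhds hxT)] with j hj
    exact T.symm_apply_mk_proj (T.mem_source.2 hj)
  -- The uniform bound `c < 1` passes to the limit and keeps it in the open disc bundle.
  have hle : h.dualNormSq (T.toOpenPartialHomeomorph.symm (x, w)) ≤ c :=
    le_of_tendsto ((h.continuous_dualNormSq.tendsto _).comp hlim)
      (hφ.tendsto_atTop.eventually ha)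
  exact ⟨⟨T.toOpenPartialHomeomorph.symm (x, w), hle.trans_lt hc⟩, φ, hφ,
    tendsto_subtype_rng.2 hlim⟩

variable [FiniteDimensional ℂ E] [ContMDiffVectorBundle ω ℂ L 𝓘(ℂ, E)]
  (gM : Bundle.ContMDiffRiemannianMetric 𝓘(ℝ, E) ∞ E (fun x : M ↦ TangentSpace 𝓘(ℝ, E) x))
  (hM : IsHermitianWithForm 𝓘(ℝ, E) gM h.curvatureForm)

theorem metricDist_discProj_le (p q : discBundle h) :
    metricDist 𝓘(ℝ, E) gM (discProj h p) (discProj h q) ≤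
      metricDist (totalModel E) (discMetric h gM hM) p q := by
  refine metricDist_map_le _ _ (contMDiff_discProj h) (fun p v ↦ ?_) p q
  rw [mfderiv_discProj]
  exact inner_le_discInner h gM hM p v

theorem edist_logDefect_le (p q : discBundle h) :
    edist (logDefect h p) (logDefect h q) ≤
      2 * metricDist (totalModel E) (discMetric h gM hM) p q := by
  refine edist_map_le (C := 2) _ (contMDiff_logDefect h) two_ne_zero (fun p v ↦ ?_) p q
  have h1 := sq_mfderiv_logDefect_le h gM hM p v
  have h2 : 0 ≤ discInner h gM p v v :=
    (inner_self_nonneg gM _ _).trans (inner_le_discInner h gM hM p v)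
  -- The sharp estimate gives the constant `√2`; the rounder `2` suffices, as `2 ≤ 2²`.
  refine h1.trans (mul_le_mul_of_nonneg_right ?_ h2)
  norm_num

theorem isCompleteMetric_discMetric [T2Space M] (hcomplete : IsCompleteMetric 𝓘(ℝ, E) gM) :
    IsCompleteMetric (totalModel E) (discMetric h gM hM) := by
  intro a ha
  have : LocallyCompactSpace E :=
    haveI : ProperSpace E := FiniteDimensional.proper ℂ E
    inferInstance
  -- With the Hausdorff property this makes `M` regular, as needed to pass from metric to
  -- topological convergence.
  have : LocallyCompactSpace M := ChartedSpace.locallyCompactSpace E M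
  obtain ⟨x, hx⟩ := hcomplete (fun j ↦ discProj h (a j)) fun ε hε ↦ by
    obtain ⟨N, hN⟩ := ha ε hε
    exact ⟨N, fun j hj k hk ↦ (metricDist_discProj_le h gM hM _ _).trans_lt (hN j hj k hk)⟩
  have hx' := tendsto_of_tendsto_metricDist gM hx
  obtain ⟨N, hN⟩ := ha 1 one_pos
  -- Beyond `N` the terms are within distance `1` of `a N`, so `log (1 - |v|²)` drops by at most `2`
  -- below its value there.
  have hbound : ∀ᶠ j in atTop,
      h.dualNormSq (a j).1 ≤ 1 - Real.exp (logDefect h (a N) - 2) := by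
    filter_upwards [eventually_ge_atTop N] with j hj
    have h1 : edist (logDefect h (a j)) (logDefect h (a N)) ≤ ENNReal.ofReal 2 := by
      refine (edist_logDefect_le h gM hM _ _).trans ?_
      refine (mul_le_mul_right (hN j hj N le_rfl).le 2).trans ?_
      simp
    rw [edist_dist, ENNReal.ofReal_le_ofReal_iff zero_le_two, Real.dist_eq, abs_le] at h1
    have h2 : 0 < 1 - h.dualNormSq (a j).1 := sub_pos.2 (a j).2
    have h3 : Real.exp (logDefect h (a N) - 2) ≤ 1 - h.dualNormSq (a j).1 := by
      rw [← Real.le_log_iff_exp_le h2]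
      have h4 := h1.1
      rw [logDefect] at h4
      linarith
    linarith
  -- The zero vector over `x` serves only as the centre of a chart of the disc bundle over `x`.
  obtain ⟨p, φ, hφ, hp⟩ := exists_subseq_tendsto h (p₀ := discZero h x) hx'
    (sub_lt_self 1 (Real.exp_pos _)) hbound
  exact ⟨p, tendsto_metricDist_of_subseq _ ha hφ hp⟩

end Completeness

end DiscBundle

end

theorem mainTheorem6
    {E : Type*} [NormedAddCommGroup E] [NormedSpace ℂ E] [FiniteDimensional ℂ E]
    {M : Type*} [TopologicalSpace M] [T2Space M] [ChartedSpace E M] [IsManifold 𝓘(ℂ, E) ω M]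
    (L : M → Type*) [∀ x, AddCommGroup (L x)] [∀ x, Module ℂ (L x)]
    [∀ x, TopologicalSpace (L x)] [TopologicalSpace (Bundle.TotalSpace ℂ L)]
    [FiberBundle ℂ L] [VectorBundle ℂ ℂ L] [ContMDiffVectorBundle ω ℂ L 𝓘(ℂ, E)]
    (h : DiscBundle.HermitianMetric E L)
    (gM : Bundle.ContMDiffRiemannianMetric 𝓘(ℝ, E) ∞ E (fun x : M ↦ TangentSpace 𝓘(ℝ, E) x))
    (hM : DiscBundle.IsHermitianWithForm 𝓘(ℝ, E) gM h.curvatureForm)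
    (hcomplete : DiscBundle.IsCompleteMetric 𝓘(ℝ, E) gM) :
    ∃ gD : Bundle.ContMDiffRiemannianMetric (DiscBundle.totalModel E) ∞ (E × (ℂ →L[ℂ] ℂ))
        (fun p : DiscBundle.discBundle h ↦ TangentSpace (DiscBundle.totalModel E) p),
      DiscBundle.IsHermitianWithForm (DiscBundle.totalModel E) gD (DiscBundle.discForm h) ∧
        DiscBundle.IsCompleteMetric (DiscBundle.totalModel E) gD :=
  ⟨DiscBundle.discMetric h gM hM, DiscBundle.isHermitianWithForm_discMetric h gM hM,
    DiscBundle.isCompleteMetric_discMetric h gM hM hcomplete⟩
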